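/- Let $N\ge 1$, $m_0>0$, and let $C(\mu)=\mu^{2N+1}+c_2\mu^{2N-1}+c_3\mu^{2N-2}+\dots+c_{2N+1}$ be a real polynomial (with vanishing coefficient of $\mu^{2N}$) all of whose roots are real; list them with multiplicities as $r_1\le r_2\le\dots\le r_{2N+1}$. For real functions $w_1,\dots,w_N$ of $x$ put $$w(x;\mu)=\mu^N+w_1(x)\mu^{N-1}+\dots+w_N(x),$$ and consider the base system $$C(\mu)=m_0\left(w_{xx}\,w-\tfrac12 w_x^2\right)+(\mu-2w_1)\,w^2 ,\qquad (1)$$ understood as an identity of polynomials in $\mu$ for every $x$. We say that $(w_1,\dots,w_N)$ satisfies the gap condition at $x$ if all roots of $w(x;\cdot)$ are real and, listed with multiplicities as $q_1(x)\le\dots\le q_N(x)$, satisfy $r_{2i}\le q_i(x)\le r_{2i+1}$ for $i=1,\dots,N$. Let $(w_1,\dots,w_N)$ be a twice differentiable solution of (1) on an open interval $J\ni 0$ which satisfies the gap condition at $x=0$. If $q_1(0),\dots,q_N(0)$ are not pairwise distinct, assume in addition that the gap condition holds at all $x$ in some neighbourhood of $0$. Then $(w_1,\dots,w_N)$ extends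 to a $C^\infty$ solution of (1) on all of $\mathbb{R}$, and the extended solution satisfies the gap condition at every $x\in\mathbb{R}$; let $q_1(x)\le\dots\le q_N(x)$ denote the roots of $w(x;\cdot)$ for the extended solution. Moreover, suppose that $r_{2i}<q_i(\tilde x)<r_{2i+1}$ for some $i$ and some $\tilde x\in\mathbb{R}$, and let $I_i$ be the connected component of the set $\{x\in\mathbb{R} : r_{2i}<q_i(x)<r_{2i+1}\}$ containing $\tilde x$. Then $I_i$ is open, $q_i$ is $C^\infty$ on $I_i$, and for all $x\in I_i$ we have $\frac{d}{dx}q_i(x)\ne 0$ and $$\frac12\Bigl(\frac{dq_i}{dx}(x)\prod_{s\ne i}\bigl(q_i(x)-q_s(x)\bigr)\Bigr)^2=-\frac{C(q_i(x))}{m_0}.$$ -/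

import Mathlib

open Polynomial Set Filter Topology
open scoped ContDiff

/-- The polynomial `v_1 μ^(N-1) + v_2 μ^(N-2) + ⋯ + v_N`; the entry `v k` stands for `v_{k+1}`. -/
noncomputable def lowPoly {N : ℕ} (v : Fin N → ℝ) : ℝ[X] :=
  ∑ k : Fin N, C (v k) * X ^ (N - 1 - (k : ℕ))

/-- The monic polynomial `w(μ) = μ^N + w_1 μ^(N-1) + ⋯ + w_N`. -/
noncomputable def wPoly {N : ℕ} (v : Fin N → ℝ) : ℝ[X] :=
  X ^ N + lowPoly v

/-- The monic polynomial `C(μ) = μ^(2N+1) + 0 μ^(2N) + c_2 μ^(2N-1) + ⋯ + c_{2N+1}`; the entry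
`c k` stands for `c_{k+2}`. -/
noncomputable def basePoly {N : ℕ} (c : Fin (2 * N) → ℝ) : ℝ[X] :=
  X ^ (2 * N + 1) + lowPoly c

/-- On the open set `J` the curve `x ↦ (w_1(x), …, w_N(x))` is twice differentiable and solves
`C(μ) = m₀ (w_xx w - ½ w_x²) + (μ - 2 w_1) w²`, an identity of polynomials in `μ`. -/
def IsBaseSolutionOn {N : ℕ} [NeZero N] (m₀ : ℝ) (c : Fin (2 * N) → ℝ) (J : Set ℝ)
    (w : ℝ → Fin N → ℝ) : Prop :=
  ∀ x ∈ J, DifferentiableAt ℝ w x ∧ DifferentiableAt ℝ (deriv w) x ∧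
    basePoly c =
      C m₀ * (lowPoly (deriv (deriv w) x) * wPoly (w x)
        - C (1 / 2) * lowPoly (deriv w x) ^ 2)
      + (X - C (2 * w x 0)) * wPoly (w x) ^ 2

/-- All zeros of `μ^N + v_1 μ^(N-1) + ⋯ + v_N` are real, and `q_1 ≤ ⋯ ≤ q_N` is the list of
them with multiplicities. -/
def IsRootList {N : ℕ} (v : Fin N → ℝ) (q : Fin N → ℝ) : Prop :=
  Monotone q ∧ wPoly v = ∏ i, (X - C (q i))

/-- For `i = 1, …, N`, the number `r_{2i}`, where `r_1, …, r_{2N+1}` is indexed by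
`Fin (2 * N + 1)`, starting from `0`, and `i` by `Fin N`, starting from `0`. -/
def gapLeft {N : ℕ} (r : Fin (2 * N + 1) → ℝ) (i : Fin N) : ℝ :=
  r ⟨2 * (i : ℕ) + 1, by omega⟩

/-- For `i = 1, …, N`, the number `r_{2i+1}`, with the same indexing. -/
def gapRight {N : ℕ} (r : Fin (2 * N + 1) → ℝ) (i : Fin N) : ℝ :=
  r ⟨2 * (i : ℕ) + 2, by omega⟩

/-- `r_{2i} ≤ q_i ≤ r_{2i+1}` for all `i = 1, …, N`. -/
def InGaps {N : ℕ} (r : Fin (2 * N + 1) → ℝ) (q : Fin N → ℝ) : Prop :=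
  ∀ i, gapLeft r i ≤ q i ∧ q i ≤ gapRight r i

/-! ### Polynomials with prescribed lower coefficients -/

section LowPoly

variable {N : ℕ}

/-! Let ρ_0 ≤ … ≤ ρ_N be the odd-numbered roots r_1, r_3, …, r_{2N+1} of C. Under the gap condition
the roots of w interlace the ρ_i, so w = ∑ y_i² ∏_{j≠i} (μ − ρ_j) with y on the unit sphere
(`Interlaces.exists_nodeSum`). In the coordinates y the base system becomes the Neumann system 2 m₀
y_i'' = (φ − ρ_i) y_i on the sphere. Its flow is complete, because the sphere is compact and the
energy bounds the velocity (`exists_neumann_flow`), and C is a conserved polynomial of it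
(`spectralPoly_const`). Suitable Neumann data therefore give a global smooth solution
(`exists_global_baseSolution`), which extends w by uniqueness (`IsBaseSolutionOn.eqOn`).

The delicate point is the initial velocity: where y_i = 0, the value prescribed for v_i² must be
shown to be nonnegative. If the gap condition holds near 0, it is a second derivative at a minimum
(`exists_neumann_data_of_eventually`). If the q_i(0) are distinct, its sign comes from the
interlacing (`exists_neumann_data_of_injective`). Coinciding ρ_i make the node polynomials
dependent; one then keeps one index per value and divides by the common factor.

Convex combinations of node polynomials have interlacing roots (`exists_interlaces`), which gives
q_i ≤ r_{2i+1}. For the lower bound, (1) at a root of w reads C = −½ m₀ w_x² ≤ 0, whereas C > 0 on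
(r_{2i−1}, r_{2i}), so no root can enter that interval (`inGaps_of_inGaps_zero`). Differentiating
w(x; q_i(x)) = 0 turns the same relation into the formula for q_i'. -/

theorem map_lowPoly (l : ℝ[X] →ₗ[ℝ] ℝ) (v : Fin N → ℝ) :
    l (lowPoly v) = ∑ k : Fin N, v k * l (X ^ (N - 1 - (k : ℕ))) := by
  simp only [lowPoly, map_sum, ← smul_eq_C_mul, map_smul, smul_eq_mul]

theorem degree_lowPoly_lt (v : Fin N → ℝ) : (lowPoly v).degree < N := by
  rw [← mem_degreeLT]
  refine Submodule.sum_mem _ fun k _ => ?_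
  rw [mem_degreeLT]
  refine (degree_C_mul_X_pow_le _ _).trans_lt ?_
  have := k.2
  exact_mod_cast (by omega : N - 1 - (k : ℕ) < N)

theorem coeff_lowPoly (v : Fin N → ℝ) (k : Fin N) : (lowPoly v).coeff (N - 1 - (k : ℕ)) = v k := by
  rw [lowPoly, finsetSum_coeff, Finset.sum_eq_single k]
  · simp
  · intro b _ hb
    rw [coeff_C_mul, coeff_X_pow, if_neg, mul_zero]
    intro h
    exact hb (Fin.ext (by have := b.2; have := k.2; omega))
  · simp

theorem coeff_lowPoly_of_le (v : Fin N → ℝ) {n : ℕ} (h : N ≤ n) : (lowPoly v).coeff n = 0 :=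
  coeff_eq_zero_of_degree_lt ((degree_lowPoly_lt v).trans_le (by exact_mod_cast h))

theorem lowPoly_injective : Function.Injective (lowPoly : (Fin N → ℝ) → ℝ[X]) := by
  intro v u h
  ext k
  rw [← coeff_lowPoly v k, h, coeff_lowPoly]

/-- The coefficients of `μ^(N-1), …, μ^0` of a polynomial. -/
noncomputable def lowCoeffs (N : ℕ) (p : ℝ[X]) : Fin N → ℝ := fun k => p.coeff (N - 1 - (k : ℕ))

theorem lowPoly_lowCoeffs {p : ℝ[X]} (hp : p.degree < N) : lowPoly (lowCoeffs N p) = p := by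
  ext n
  by_cases h : n < N
  · have := coeff_lowPoly (lowCoeffs N p) ⟨N - 1 - n, by omega⟩
    have e : N - 1 - (N - 1 - n) = n := by omega
    simpa [lowCoeffs, e] using this
  · rw [coeff_lowPoly_of_le _ (by omega), coeff_eq_zero_of_degree_lt]
    exact hp.trans_le (by exact_mod_cast (by omega : N ≤ n))

theorem wPoly_lowCoeffs {p : ℝ[X]} (hp : p.Monic) (hd : p.natDegree = N) :
    wPoly (lowCoeffs N p) = p := by
  have h : lowCoeffs N p = lowCoeffs N (p - X ^ N) := by
    ext k
    have := k.2
    simp only [lowCoeffs, coeff_sub, coeff_X_pow]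
    rw [if_neg (by omega), sub_zero]
  rw [wPoly, h, lowPoly_lowCoeffs, add_sub_cancel]
  have := degree_sub_lt_left (q := X ^ N) (by rw [degree_eq_natDegree hp.ne_zero, hd, degree_X_pow])
    hp.ne_zero (by rw [hp.leadingCoeff, leadingCoeff_X_pow])
  rwa [degree_eq_natDegree hp.ne_zero, hd] at this

theorem wPoly_monic (v : Fin N → ℝ) : (wPoly v).Monic :=
  monic_X_pow_add (degree_lowPoly_lt v)

theorem natDegree_wPoly (v : Fin N → ℝ) : (wPoly v).natDegree = N := by
  have h := degree_add_eq_left_of_degree_lt (p := X ^ N) (q := lowPoly v)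
    (by rw [degree_X_pow]; exact degree_lowPoly_lt v)
  exact natDegree_eq_of_degree_eq_some (by rw [wPoly, h, degree_X_pow])

/-- Polynomial-valued curves are differentiated through linear functionals such as evaluations, so
that no topology on polynomials is needed. -/
theorem HasDerivAt.map_lowPoly (l : ℝ[X] →ₗ[ℝ] ℝ) {w : ℝ → Fin N → ℝ} {w' : Fin N → ℝ} {x : ℝ}
    (h : HasDerivAt w w' x) : HasDerivAt (fun x => l (lowPoly (w x))) (l (lowPoly w')) x := by
  simp only [_root_.map_lowPoly]
  exact HasDerivAt.fun_sum fun k _ => (hasDerivAt_pi.1 h k).mul_const _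

theorem HasDerivAt.map_wPoly (l : ℝ[X] →ₗ[ℝ] ℝ) {w : ℝ → Fin N → ℝ} {w' : Fin N → ℝ} {x : ℝ}
    (h : HasDerivAt w w' x) : HasDerivAt (fun x => l (wPoly (w x))) (l (lowPoly w')) x := by
  simp only [wPoly, map_add]
  exact (h.map_lowPoly l).const_add _

end LowPoly

/-! ### Normal form of the base system -/

section Acceleration

variable {E : Type*} [NormedAddCommGroup E] [NormedSpace ℝ E] {N : ℕ}

/-- A family of polynomials with smooth coefficients. -/
def CoeffContDiff (p : E → ℝ[X]) : Prop := ∀ n, ContDiff ℝ ∞ fun x => (p x).coeff n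

theorem CoeffContDiff.const (p : ℝ[X]) : CoeffContDiff fun _ : E => p := fun _ => contDiff_const

theorem CoeffContDiff.add {p q : E → ℝ[X]} (hp : CoeffContDiff p) (hq : CoeffContDiff q) :
    CoeffContDiff fun x => p x + q x := fun n => by
  simpa only [coeff_add] using (hp n).add (hq n)

theorem CoeffContDiff.sub {p q : E → ℝ[X]} (hp : CoeffContDiff p) (hq : CoeffContDiff q) :
    CoeffContDiff fun x => p x - q x := fun n => by
  simpa only [coeff_sub] using (hp n).sub (hq n)

theorem CoeffContDiff.mul {p q : E → ℝ[X]} (hp : CoeffContDiff p) (hq : CoeffContDiff q) :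
    CoeffContDiff fun x => p x * q x := fun n => by
  simp only [coeff_mul]
  exact ContDiff.sum fun i _ => (hp _).mul (hq _)

theorem CoeffContDiff.C_comp {f : E → ℝ} (hf : ContDiff ℝ ∞ f) :
    CoeffContDiff fun x => C (f x) := fun n => by
  simp only [coeff_C]
  split_ifs
  exacts [hf, contDiff_const]

theorem CoeffContDiff.lowPoly_comp {v : E → Fin N → ℝ} (hv : ContDiff ℝ ∞ v) :
    CoeffContDiff fun x => lowPoly (v x) := fun n => by
  have := fun x => map_lowPoly (lcoeff ℝ n) (v x)
  simp only [lcoeff_apply] at this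
  simp only [this]
  exact ContDiff.sum fun k _ => (contDiff_pi.1 hv k).mul contDiff_const

/-- The second derivative of a solution of the base system is a smooth function of the
solution and its first derivative. -/
theorem exists_contDiff_acceleration [NeZero N] {m₀ : ℝ} (hm₀ : m₀ ≠ 0) (B : ℝ[X]) :
    ∃ Φ : (Fin N → ℝ) × (Fin N → ℝ) → Fin N → ℝ, ContDiff ℝ ∞ Φ ∧ ∀ v u a : Fin N → ℝ,
      B = C m₀ * (lowPoly a * wPoly v - C (1 / 2) * lowPoly u ^ 2)
        + (X - C (2 * v 0)) * wPoly v ^ 2 → a = Φ (v, u) := by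
  let P : (Fin N → ℝ) × (Fin N → ℝ) → (Fin N → ℝ) → Prop := fun z a =>
    B = C m₀ * (lowPoly a * wPoly z.1 - C (1 / 2) * lowPoly z.2 ^ 2)
        + (X - C (2 * z.1 0)) * wPoly z.1 ^ 2
  have hl1 : CoeffContDiff fun z : (Fin N → ℝ) × (Fin N → ℝ) => lowPoly z.1 :=
    .lowPoly_comp contDiff_fst
  have hl2 : CoeffContDiff fun z : (Fin N → ℝ) × (Fin N → ℝ) => lowPoly z.2 :=
    .lowPoly_comp contDiff_snd
  have hw : CoeffContDiff fun z : (Fin N → ℝ) × (Fin N → ℝ) => wPoly z.1 :=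
    (CoeffContDiff.const _).add hl1
  have h0 : CoeffContDiff fun z : (Fin N → ℝ) × (Fin N → ℝ) => C (2 * z.1 0) :=
    .C_comp (by fun_prop)
  -- The base system solved for the product w_xx · w.
  let H : (Fin N → ℝ) × (Fin N → ℝ) → ℝ[X] := fun z =>
    C (1 / 2) * (lowPoly z.2 * lowPoly z.2) +
      C m₀⁻¹ * (B - (X - C (2 * z.1 0)) * (wPoly z.1 * wPoly z.1))
  have hH : CoeffContDiff H :=
    ((CoeffContDiff.const _).mul (hl2.mul hl2)).add ((CoeffContDiff.const _).mul
      ((CoeffContDiff.const _).sub (((CoeffContDiff.const _).sub h0).mul (hw.mul hw))))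
  have hPH : ∀ z a, P z a → lowPoly a * wPoly z.1 = H z := by
    intro z a h
    have e : (C m₀⁻¹ : ℝ[X]) * C m₀ = 1 := by rw [← C_mul, inv_mul_cancel₀ hm₀, C_1]
    simp only [H, P] at h ⊢
    rw [h]
    linear_combination (-(lowPoly a * wPoly z.1 - C (1 / 2) * lowPoly z.2 ^ 2)) * e
  -- Since w is monic, the coefficient of μ^(m+N) in w_xx · w is the m-th coefficient of w_xx plus
  -- terms in its higher coefficients. The system is thus triangular and is solved downwards from m
  -- = N; `d` bounds N − m.
  have key : ∀ d m : ℕ, N ≤ m + d → ∃ φ : (Fin N → ℝ) × (Fin N → ℝ) → ℝ, ContDiff ℝ ∞ φ ∧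
      ∀ z a, P z a → (lowPoly a).coeff m = φ z := by
    intro d
    induction d with
    | zero => exact fun m hm => ⟨0, contDiff_const, fun z a _ => coeff_lowPoly_of_le a hm⟩
    | succ d ih =>
      intro m hm
      have : ∀ i, ∃ φ : (Fin N → ℝ) × (Fin N → ℝ) → ℝ, ContDiff ℝ ∞ φ ∧
          (m < i → ∀ z a, P z a → (lowPoly a).coeff i = φ z) := by
        intro i
        by_cases hi : m < i
        · obtain ⟨φ, h1, h2⟩ := ih i (by omega)
          exact ⟨φ, h1, fun _ => h2⟩
        · exact ⟨0, contDiff_const, fun h => absurd h hi⟩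
      choose φ hφ hφ' using this
      refine ⟨fun z => (H z).coeff (m + N) - ∑ i ∈ Finset.HasAntidiagonal.antidiagonal (m + N),
        φ i.1 z * (lowPoly z.1).coeff i.2, ?_, ?_⟩
      · exact (hH _).sub (ContDiff.sum fun i _ => (hφ _).mul (hl1 _))
      · intro z a h
        beta_reduce
        rw [← hPH z a h, wPoly, mul_add, coeff_add, coeff_mul_X_pow, coeff_mul, add_sub_assoc,
          left_eq_add, sub_eq_zero]
        refine Finset.sum_congr rfl fun i hi => ?_
        rw [Finset.HasAntidiagonal.mem_antidiagonal] at hi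
        -- If `i.1 ≤ m` then `i.2 ≥ N`, so the other factor vanishes and the default value 0 of `φ`
        -- is harmless.
        by_cases h' : m < i.1
        · rw [hφ' _ h' z a h]
        · rw [coeff_lowPoly_of_le z.1 (by omega), mul_zero, mul_zero]
  choose φ hφ hφ' using fun m => key N m (by omega)
  refine ⟨fun z k => φ (N - 1 - (k : ℕ)) z, contDiff_pi.2 fun k => hφ _, fun v u a h => ?_⟩
  ext k
  rw [← coeff_lowPoly a k]
  exact hφ' _ (v, u) a h

end Acceleration

/-! ### Uniqueness, global existence and smoothness for autonomous ODEs -/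

section ODE

variable {E : Type*} [NormedAddCommGroup E] [NormedSpace ℝ E] [FiniteDimensional ℝ E]

/-- On a compact time interval both curves stay in one closed ball, where the C¹ field is Lipschitz;
Grönwall uniqueness then applies forwards and backwards. -/
theorem eqOn_of_hasDerivAt_field {F : E → E} (hF : ContDiff ℝ 1 F) {J : Set ℝ}
    (hJ : J.OrdConnected) {f g : ℝ → E} {t₀ : ℝ} (h0 : t₀ ∈ J)
    (hf : ∀ t ∈ J, HasDerivAt f (F (f t)) t) (hg : ∀ t ∈ J, HasDerivAt g (F (g t)) t)
    (h : f t₀ = g t₀) : EqOn f g J := by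
  have : ProperSpace E := FiniteDimensional.proper ℝ E
  have cf : ContinuousOn f J := fun t ht => (hf t ht).continuousAt.continuousWithinAt
  have cg : ContinuousOn g J := fun t ht => (hg t ht).continuousAt.continuousWithinAt
  have bound : ∀ a ∈ J, ∀ b ∈ J, ∃ (K : NNReal) (s : Set E), LipschitzOnWith K F s ∧
      ∀ t ∈ Icc a b, f t ∈ s ∧ g t ∈ s := by
    intro a ha b hb
    have hs := hJ.out ha hb
    have h1 := (isCompact_Icc.image_of_continuousOn (cf.mono hs)).isBounded
    have h2 := (isCompact_Icc.image_of_continuousOn (cg.mono hs)).isBounded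
    obtain ⟨R, hR⟩ := (h1.union h2).subset_closedBall 0
    obtain ⟨K, hK⟩ := (hF.contDiffOn (s := Metric.closedBall 0 R)).exists_lipschitzOnWith
      one_ne_zero (convex_closedBall _ _) (isCompact_closedBall _ _)
    exact ⟨K, _, hK, fun t ht => ⟨hR (.inl ⟨t, ht, rfl⟩), hR (.inr ⟨t, ht, rfl⟩)⟩⟩
  intro x hx
  rcases le_total t₀ x with hle | hle
  · obtain ⟨K, s, hK, hs⟩ := bound t₀ h0 x hx
    have hs' := hJ.out h0 hx
    exact ODE_solution_unique_of_mem_Icc_right (v := fun _ => F) (s := fun _ => s)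
      (fun _ _ => hK) (cf.mono hs')
      (fun t ht => (hf t (hs' (Ico_subset_Icc_self ht))).hasDerivWithinAt)
      (fun t ht => (hs t (Ico_subset_Icc_self ht)).1) (cg.mono hs')
      (fun t ht => (hg t (hs' (Ico_subset_Icc_self ht))).hasDerivWithinAt)
      (fun t ht => (hs t (Ico_subset_Icc_self ht)).2) h ⟨hle, le_rfl⟩
  · obtain ⟨K, s, hK, hs⟩ := bound x hx t₀ h0
    have hs' := hJ.out hx h0
    exact ODE_solution_unique_of_mem_Icc_left (v := fun _ => F) (s := fun _ => s)
      (fun _ _ => hK) (cf.mono hs')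
      (fun t ht => (hf t (hs' (Ioc_subset_Icc_self ht))).hasDerivWithinAt)
      (fun t ht => (hs t (Ioc_subset_Icc_self ht)).1) (cg.mono hs')
      (fun t ht => (hg t (hs' (Ioc_subset_Icc_self ht))).hasDerivWithinAt)
      (fun t ht => (hs t (Ioc_subset_Icc_self ht)).2) h ⟨le_rfl, hle⟩

/-- The field is bounded and globally Lipschitz, so Picard–Lindelöf works on every [−n, n], and the
solutions agree by uniqueness. -/
theorem exists_global_of_hasCompactSupport {F : E → E} (hF : ContDiff ℝ 1 F)
    (hc : HasCompactSupport F) (z : E) :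
    ∃ γ : ℝ → E, γ 0 = z ∧ ∀ t, HasDerivAt γ (F (γ t)) t := by
  have : CompleteSpace E := FiniteDimensional.complete ℝ E
  obtain ⟨K, hK⟩ := hF.lipschitzWith_of_hasCompactSupport hc one_ne_zero
  obtain ⟨L, hL⟩ := hc.exists_bound_of_continuous hF.continuous
  have loc : ∀ n : ℕ, ∃ γ : ℝ → E, γ 0 = z ∧
      ∀ t ∈ Ioo (-(n : ℝ)) n, HasDerivAt γ (F (γ t)) t := by
    intro n
    have h0 : (0 : ℝ) ∈ Icc (-(n : ℝ)) n := by simp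
    -- With speed at most `L`, a curve moves at most `L * n` in time `n`.
    have hP : IsPicardLindelof (fun _ => F) (⟨0, h0⟩ : Icc (-(n : ℝ)) n) z
        (L.toNNReal * n) 0 L.toNNReal K :=
      .of_time_independent (fun x _ => (hL x).trans (Real.le_coe_toNNReal L)) hK.lipschitzOnWith
        (by simp)
    obtain ⟨γ, h1, h2⟩ := hP.exists_eq_forall_mem_Icc_hasDerivWithinAt₀
    exact ⟨γ, h1, fun t ht => (h2 t (Ioo_subset_Icc_self ht)).hasDerivAt (Icc_mem_nhds ht.1 ht.2)⟩
  choose γ h1 h2 using loc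
  have agree : ∀ n m : ℕ, 0 < n → n ≤ m → EqOn (γ n) (γ m) (Ioo (-(n : ℝ)) n) := by
    intro n m hn hnm
    have hnm' : (n : ℝ) ≤ m := by exact_mod_cast hnm
    have hn' : (0 : ℝ) < n := by exact_mod_cast hn
    refine eqOn_of_hasDerivAt_field hF ordConnected_Ioo (t₀ := 0) (by simp [hn']) (h2 n) ?_
      (by rw [h1, h1])
    exact fun t ht => h2 m t ⟨by linarith [ht.1], by linarith [ht.2]⟩
  -- The index ⌈|t|⌉ + 1 makes `t` an interior point of its interval.
  refine ⟨fun t => γ (⌈|t|⌉₊ + 1) t, h1 _, fun t => ?_⟩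
  have ht : ∀ s : ℝ, s ∈ Ioo (-((⌈|s|⌉₊ + 1 : ℕ) : ℝ)) ((⌈|s|⌉₊ + 1 : ℕ) : ℝ) := by
    intro s
    have := Nat.le_ceil |s|
    rw [mem_Ioo, ← abs_lt]
    push_cast
    linarith
  refine (h2 _ t (ht t)).congr_of_eventuallyEq ?_
  filter_upwards [isOpen_Ioo.mem_nhds (ht t)] with s hs
  rcases le_total ⌈|s|⌉₊ ⌈|t|⌉₊ with h | h
  · exact agree _ _ (by omega) (by omega) (ht s)
  · exact (agree _ _ (by omega) (by omega) hs).symm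

end ODE

/-- Bootstrapping: if γ is Cⁿ then so is γ' = F ∘ γ. -/
theorem contDiff_of_hasDerivAt_field {E : Type*} [NormedAddCommGroup E] [NormedSpace ℝ E]
    {F : E → E} (hF : ContDiff ℝ ∞ F) {γ : ℝ → E}
    (h : ∀ t, HasDerivAt γ (F (γ t)) t) : ContDiff ℝ ∞ γ := by
  rw [contDiff_infty]
  intro n
  induction n with
  | zero =>
    exact contDiff_zero.2 (continuous_iff_continuousAt.2 fun t => (h t).continuousAt)
  | succ n ih =>
    have hd : deriv γ = fun t => F (γ t) := funext fun t => (h t).deriv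
    rw [Nat.cast_succ, contDiff_succ_iff_deriv]
    refine ⟨fun t => (h t).differentiableAt, by simp, ?_⟩
    rw [hd]
    exact (contDiff_infty.1 hF n).comp ih

/-! ### Interlacing roots and convex combinations of node polynomials -/

section Interlacing

variable {N : ℕ}

/-- The product of `X - ρ j` over all `j ≠ i`. -/
noncomputable def nodePoly (ρ : Fin (N + 1) → ℝ) (i : Fin (N + 1)) : ℝ[X] :=
  ∏ s : Fin N, (X - C (ρ (i.succAbove s)))

theorem X_sub_C_mul_nodePoly (ρ : Fin (N + 1) → ℝ) (i : Fin (N + 1)) :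
    (X - C (ρ i)) * nodePoly ρ i = ∏ j, (X - C (ρ j)) :=
  (Fin.prod_univ_succAbove (fun j => X - C (ρ j)) i).symm

theorem nodePoly_monic (ρ : Fin (N + 1) → ℝ) (i : Fin (N + 1)) : (nodePoly ρ i).Monic :=
  monic_prod_of_monic _ _ fun _ _ => monic_X_sub_C _

theorem natDegree_nodePoly (ρ : Fin (N + 1) → ℝ) (i : Fin (N + 1)) :
    (nodePoly ρ i).natDegree = N := by
  rw [nodePoly, natDegree_finsetProd_X_sub_C_eq_card]
  simp

theorem coeff_nodePoly (ρ : Fin (N + 1) → ℝ) (i : Fin (N + 1)) : (nodePoly ρ i).coeff N = 1 := by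
  have := (nodePoly_monic ρ i).coeff_natDegree
  rwa [natDegree_nodePoly] at this

theorem eval_nodePoly (ρ : Fin (N + 1) → ℝ) (i : Fin (N + 1)) (t : ℝ) :
    (nodePoly ρ i).eval t = ∏ s : Fin N, (t - ρ (i.succAbove s)) := by
  simp [nodePoly, eval_prod]

theorem eval_nodePoly_of_ne (ρ : Fin (N + 1) → ℝ) {i j : Fin (N + 1)} (h : j ≠ i) :
    (nodePoly ρ i).eval (ρ j) = 0 := by
  obtain ⟨s, hs⟩ := Fin.exists_succAbove_eq h
  rw [eval_nodePoly]
  exact Finset.prod_eq_zero (Finset.mem_univ s) (by rw [hs, sub_self])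

/-- The combination `∑ αᵢ ∏_{j ≠ i} (X - ρⱼ)`. -/
noncomputable def nodeSum (ρ α : Fin (N + 1) → ℝ) : ℝ[X] := ∑ i, C (α i) * nodePoly ρ i

theorem eval_nodeSum (ρ α : Fin (N + 1) → ℝ) (t : ℝ) :
    (nodeSum ρ α).eval t = ∑ i, α i * (nodePoly ρ i).eval t := by
  simp [nodeSum, eval_finsetSum]

theorem eval_nodeSum_node (ρ α : Fin (N + 1) → ℝ) (i : Fin (N + 1)) :
    (nodeSum ρ α).eval (ρ i) = α i * (nodePoly ρ i).eval (ρ i) := by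
  rw [eval_nodeSum, Finset.sum_eq_single i]
  · intro j _ h
    rw [eval_nodePoly_of_ne ρ h.symm, mul_zero]
  · simp

theorem degree_nodeSum_lt (ρ α : Fin (N + 1) → ℝ) : (nodeSum ρ α).degree < (N + 1 : ℕ) := by
  rw [← mem_degreeLT]
  refine Submodule.sum_mem _ fun i _ => ?_
  rw [← smul_eq_C_mul]
  refine Submodule.smul_mem _ _ ?_
  rw [mem_degreeLT, degree_eq_natDegree (nodePoly_monic ρ i).ne_zero, natDegree_nodePoly]
  exact_mod_cast N.lt_succ_self

theorem coeff_nodeSum (ρ α : Fin (N + 1) → ℝ) : (nodeSum ρ α).coeff N = ∑ i, α i := by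
  simp [nodeSum, finsetSum_coeff, coeff_nodePoly]

theorem natDegree_nodeSum {ρ α : Fin (N + 1) → ℝ} (h : ∑ i, α i = 1) :
    (nodeSum ρ α).natDegree = N := by
  refine le_antisymm ?_ (le_natDegree_of_ne_zero (by rw [coeff_nodeSum, h]; exact one_ne_zero))
  refine natDegree_le_of_degree_le ?_
  rw [degree_le_iff_coeff_zero]
  intro m hm
  refine coeff_eq_zero_of_degree_lt ((degree_nodeSum_lt ρ α).trans_le ?_)
  have : N < m := by exact_mod_cast hm
  exact_mod_cast this

theorem nodeSum_monic {ρ α : Fin (N + 1) → ℝ} (h : ∑ i, α i = 1) : (nodeSum ρ α).Monic := by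
  rw [Monic, leadingCoeff, natDegree_nodeSum h, coeff_nodeSum, h]

theorem degree_nodeSum_lt_of_sum_eq_zero {ρ α : Fin (N + 1) → ℝ} (h : ∑ i, α i = 0) :
    (nodeSum ρ α).degree < N := by
  rw [degree_lt_iff_coeff_zero]
  intro m hm
  rcases hm.eq_or_lt with rfl | hm
  · rw [coeff_nodeSum, h]
  · exact coeff_eq_zero_of_degree_lt ((degree_nodeSum_lt ρ α).trans_le (by exact_mod_cast hm))

theorem nodeSum_add (ρ α β : Fin (N + 1) → ℝ) :
    nodeSum ρ (fun i => α i + β i) = nodeSum ρ α + nodeSum ρ β := by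
  simp [nodeSum, add_mul, Finset.sum_add_distrib]

theorem nodeSum_smul (ρ α : Fin (N + 1) → ℝ) (c : ℝ) :
    nodeSum ρ (fun i => c * α i) = C c * nodeSum ρ α := by
  simp [nodeSum, mul_assoc, Finset.mul_sum]

/-- `μ ∑ αᵢ Pᵢ = (∑ αᵢ) R + ∑ ρᵢ αᵢ Pᵢ`. -/
theorem X_mul_nodeSum (ρ α : Fin (N + 1) → ℝ) :
    X * nodeSum ρ α = C (∑ i, α i) * ∏ j, (X - C (ρ j)) + nodeSum ρ (fun i => ρ i * α i) := by
  simp only [nodeSum, map_sum, Finset.sum_mul, Finset.mul_sum]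
  rw [← Finset.sum_add_distrib]
  refine Finset.sum_congr rfl fun i _ => ?_
  rw [← X_sub_C_mul_nodePoly ρ i, C_mul]
  ring

theorem continuous_eval_nodeSum (t : ℝ) :
    Continuous fun z : (Fin (N + 1) → ℝ) × (Fin (N + 1) → ℝ) => (nodeSum z.1 z.2).eval t := by
  simp only [eval_nodeSum, eval_nodePoly]
  fun_prop

/-- `q` interlaces `ρ`: `ρ₀ ≤ q₀ ≤ ρ₁ ≤ q₁ ≤ ⋯ ≤ ρ_N`. -/
def Interlaces (ρ : Fin (N + 1) → ℝ) (q : Fin N → ℝ) : Prop :=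
  ∀ i, ρ i.castSucc ≤ q i ∧ q i ≤ ρ i.succ

/-- `q s` and `ρ (i.succAbove s)` lie on the same side of `ρ i`. These quotients are the factors of
the Lagrange coefficients. -/
theorem Interlaces.sub_div_nonneg {ρ : Fin (N + 1) → ℝ} {q : Fin N → ℝ} (hρ : Monotone ρ)
    (h : Interlaces ρ q) (i : Fin (N + 1)) (s : Fin N) :
    0 ≤ (ρ i - q s) / (ρ i - ρ (i.succAbove s)) := by
  rcases lt_or_ge s.castSucc i with hs | hs
  · rw [Fin.succAbove_of_castSucc_lt _ _ hs]
    have : ρ s.succ ≤ ρ i := hρ (by rw [Fin.lt_def] at hs; rw [Fin.le_def]; simpa using hs)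
    exact div_nonneg (by linarith [(h s).2]) (by linarith [(h s).2, (h s).1])
  · rw [Fin.succAbove_of_le_castSucc _ _ hs]
    have : ρ i ≤ ρ s.castSucc := hρ hs
    exact div_nonneg_of_nonpos (by linarith [(h s).1]) (by linarith [(h s).2, (h s).1])

/-- Lagrange interpolation at distinct nodes; the weights sum to 1 because the polynomial is monic.
-/
theorem exists_nodeSum_of_strictMono {ρ : Fin (N + 1) → ℝ} {q : Fin N → ℝ} (hρ : StrictMono ρ)
    (h : Interlaces ρ q) :
    ∃ α : Fin (N + 1) → ℝ, (∀ i, 0 ≤ α i) ∧ ∑ i, α i = 1 ∧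
      ∏ i, (X - C (q i)) = nodeSum ρ α := by
  let α : Fin (N + 1) → ℝ := fun i => ∏ s, (ρ i - q s) / (ρ i - ρ (i.succAbove s))
  have hm : (∏ i, (X - C (q i))).Monic := monic_prod_of_monic _ _ fun _ _ => monic_X_sub_C _
  have hd : (∏ i, (X - C (q i))).natDegree = N := by
    rw [natDegree_finsetProd_X_sub_C_eq_card]; simp
  have heq : ∏ i, (X - C (q i)) = nodeSum ρ α := by
    refine eq_of_degrees_lt_of_eval_index_eq (v := ρ) Finset.univ hρ.injective.injOn ?_ ?_ ?_
    · rw [degree_eq_natDegree hm.ne_zero, hd, Finset.card_univ, Fintype.card_fin]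
      exact_mod_cast N.lt_succ_self
    · simpa using degree_nodeSum_lt ρ α
    · intro i _
      rw [eval_nodeSum_node, eval_nodePoly, eval_prod, ← Finset.prod_mul_distrib]
      refine Finset.prod_congr rfl fun s _ => ?_
      rw [div_mul_cancel₀]
      · simp
      · exact sub_ne_zero.2 fun e => Fin.succAbove_ne i s (hρ.injective e).symm
  refine ⟨α, fun i => Finset.prod_nonneg fun s _ => h.sub_div_nonneg hρ.monotone i s, ?_, heq⟩
  rw [← coeff_nodeSum ρ α, ← heq]
  have := hm.coeff_natDegree
  rwa [hd] at this

theorem strictMono_perturb {ρ : Fin (N + 1) → ℝ} (hρ : Monotone ρ) {ε : ℝ} (hε : 0 < ε) :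
    StrictMono fun i => ρ i + ε * (i : ℕ) := by
  intro i j hij
  have h1 := hρ hij.le
  have h2 : ((i : ℕ) : ℝ) < (j : ℕ) := by exact_mod_cast hij
  have := mul_lt_mul_of_pos_left h2 hε
  simp only
  linarith

/-- A monic polynomial whose zeros interlace the nodes is a convex combination of the
node polynomials. -/
theorem Interlaces.exists_nodeSum {ρ : Fin (N + 1) → ℝ} {q : Fin N → ℝ} (hρ : Monotone ρ)
    (h : Interlaces ρ q) :
    ∃ α : Fin (N + 1) → ℝ, (∀ i, 0 ≤ α i) ∧ ∑ i, α i = 1 ∧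
      ∏ i, (X - C (q i)) = nodeSum ρ α := by
  -- Repeated nodes are separated by shifting `ρ i` and `q i` by `ε * i`, which preserves
  -- interlacing. The weights stay in the compact simplex, so a subsequence converges.
  let ε : ℕ → ℝ := fun n => 1 / ((n : ℝ) + 1)
  have hε : ∀ n, 0 < ε n := fun n => by positivity
  have hI : ∀ n, Interlaces (fun i => ρ i + ε n * (i : ℕ)) (fun i => q i + ε n * (i : ℕ)) := by
    intro n i
    have := hε n
    simp only [Fin.val_castSucc, Fin.val_succ, Nat.cast_add, Nat.cast_one]
    exact ⟨by linarith [(h i).1], by linarith [(h i).2]⟩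
  choose α h1 h2 h3 using fun n => exists_nodeSum_of_strictMono (strictMono_perturb hρ (hε n)) (hI n)
  obtain ⟨β, hβ, φ, hφ, ht⟩ := (isCompact_stdSimplex ℝ (Fin (N + 1))).tendsto_subseq
    (x := α) fun n => ⟨h1 n, h2 n⟩
  have hε0 : Tendsto (fun n => ε (φ n)) atTop (𝓝 0) :=
    tendsto_one_div_add_atTop_nhds_zero_nat.comp hφ.tendsto_atTop
  refine ⟨β, hβ.1, hβ.2, Polynomial.funext fun t => ?_⟩
  have hρt : Tendsto (fun n => fun i : Fin (N + 1) => ρ i + ε (φ n) * (i : ℕ)) atTop (𝓝 ρ) := by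
    rw [tendsto_pi_nhds]
    intro i
    simpa using (hε0.mul_const ((i : ℕ) : ℝ)).const_add (ρ i)
  have hl : Tendsto (fun n => (∏ i, (X - C (q i + ε (φ n) * (i : ℕ)))).eval t) atTop
      (𝓝 ((∏ i, (X - C (q i))).eval t)) := by
    simp only [eval_prod, eval_sub, eval_X, eval_C]
    refine tendsto_finsetProd _ fun i _ => tendsto_const_nhds.sub ?_
    simpa using (hε0.mul_const ((i : ℕ) : ℝ)).const_add (q i)
  have hr := ((continuous_eval_nodeSum t).tendsto (ρ, β)).comp (hρt.prodMk_nhds ht)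
  refine tendsto_nhds_unique hl (hr.congr fun n => ?_)
  simp only [Function.comp]
  rw [← h3]

/-- With positive weights the polynomial changes sign between consecutive nodes, and the N roots so
found exhaust its degree. -/
theorem exists_interlaces_of_pos {ρ α : Fin (N + 1) → ℝ} (hρ : StrictMono ρ)
    (hα : ∀ i, 0 < α i) (hs : ∑ i, α i = 1) :
    ∃ q : Fin N → ℝ, Interlaces ρ q ∧ nodeSum ρ α = ∏ i, (X - C (q i)) := by
  set f := nodeSum ρ α with hf
  have hneg : ∀ i : Fin N, f.eval (ρ i.castSucc) * f.eval (ρ i.succ) < 0 := by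
    intro i
    rw [hf, eval_nodeSum_node, eval_nodeSum_node, eval_nodePoly, eval_nodePoly, mul_mul_mul_comm,
      ← Finset.prod_mul_distrib]
    refine mul_neg_of_pos_of_neg (mul_pos (hα _) (hα _)) ?_
    have hlt : ρ i.castSucc < ρ i.succ := hρ Fin.castSucc_lt_succ
    -- Only the factor `s = i` has opposite signs at the two ends of the interval.
    rw [← Finset.mul_prod_erase _ _ (Finset.mem_univ i)]
    refine mul_neg_of_neg_of_pos ?_ (Finset.prod_pos fun s hs => ?_)
    · rw [Fin.succAbove_castSucc_self, Fin.succAbove_succ_self]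
      nlinarith
    · rcases lt_or_gt_of_ne (Finset.ne_of_mem_erase hs) with h | h
      · rw [Fin.succAbove_of_castSucc_lt _ _ (Fin.castSucc_lt_castSucc_iff.2 h),
          Fin.succAbove_of_castSucc_lt _ _
            ((Fin.castSucc_lt_castSucc_iff.2 h).trans Fin.castSucc_lt_succ)]
        have h1 : ρ s.castSucc < ρ i.castSucc := hρ (Fin.castSucc_lt_castSucc_iff.2 h)
        exact mul_pos (by linarith) (by linarith)
      · rw [Fin.succAbove_of_le_castSucc _ _ (Fin.castSucc_lt_castSucc_iff.2 h).le,
          Fin.succAbove_of_le_castSucc _ _ (Fin.succ_le_castSucc_iff.2 h)]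
        have h1 : ρ i.succ < ρ s.succ := hρ (Fin.succ_lt_succ_iff.2 h)
        exact mul_pos_of_neg_of_neg (by linarith) (by linarith)
  have hroot : ∀ i : Fin N, ∃ t, ρ i.castSucc < t ∧ t < ρ i.succ ∧ f.eval t = 0 := by
    intro i
    have hlt : ρ i.castSucc < ρ i.succ := hρ Fin.castSucc_lt_succ
    have hc : ContinuousOn (fun t => f.eval t) (Icc (ρ i.castSucc) (ρ i.succ)) :=
      f.continuous.continuousOn
    rcases mul_neg_iff.1 (hneg i) with h | h
    · obtain ⟨t, ht, h0⟩ := intermediate_value_Ioo' hlt.le hc ⟨h.2, h.1⟩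
      exact ⟨t, ht.1, ht.2, h0⟩
    · obtain ⟨t, ht, h0⟩ := intermediate_value_Ioo hlt.le hc ⟨h.1, h.2⟩
      exact ⟨t, ht.1, ht.2, h0⟩
  choose q h1 h2 h3 using hroot
  have hq : StrictMono q := by
    intro i j hij
    have := hρ.monotone (Fin.succ_le_castSucc_iff.2 hij)
    linarith [h2 i, h1 j]
  refine ⟨q, fun i => ⟨(h1 i).le, (h2 i).le⟩, ?_⟩
  have hm : (∏ i, (X - C (q i))).Monic := monic_prod_of_monic _ _ fun _ _ => monic_X_sub_C _
  have hd : (∏ i, (X - C (q i))).natDegree = N := by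
    rw [natDegree_finsetProd_X_sub_C_eq_card]; simp
  have hfm : f.Monic := nodeSum_monic hs
  have hfd : f.natDegree = N := natDegree_nodeSum hs
  refine eq_of_degree_sub_lt_of_eval_index_eq (v := q) Finset.univ hq.injective.injOn ?_ ?_
  · have := degree_sub_lt_left (p := f) (q := ∏ i, (X - C (q i)))
      (by rw [degree_eq_natDegree hfm.ne_zero, degree_eq_natDegree hm.ne_zero, hfd, hd])
      hfm.ne_zero (by rw [hfm.leadingCoeff, hm.leadingCoeff])
    rw [degree_eq_natDegree hfm.ne_zero, hfd] at this
    simpa using this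
  · intro i _
    rw [h3, eval_prod, Finset.prod_eq_zero (Finset.mem_univ i) (by simp)]

/-- A convex combination of the node polynomials has real zeros, which interlace the nodes. -/
theorem exists_interlaces {ρ α : Fin (N + 1) → ℝ} (hρ : Monotone ρ)
    (hα : ∀ i, 0 ≤ α i) (hs : ∑ i, α i = 1) :
    ∃ q : Fin N → ℝ, Interlaces ρ q ∧ nodeSum ρ α = ∏ i, (X - C (q i)) := by
  let ε : ℕ → ℝ := fun n => 1 / ((n : ℝ) + 1)
  have hε : ∀ n, 0 < ε n := fun n => by positivity
  have hε1 : ∀ n, ε n ≤ 1 := fun n => by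
    rw [div_le_one (by positivity)]
    linarith [(Nat.cast_nonneg n : (0 : ℝ) ≤ n)]
  have hD : ∀ n, 0 < 1 + ((N : ℝ) + 1) * ε n := fun n => by have := hε n; positivity
  -- Nodes are separated and weights made positive, then renormalised to sum 1; the roots stay in a
  -- fixed box, and a limit point is taken.
  choose q h1 h2 using fun n => exists_interlaces_of_pos (strictMono_perturb hρ (hε n))
    (α := fun i => (α i + ε n) / (1 + ((N : ℝ) + 1) * ε n))
    (fun i => div_pos (add_pos_of_nonneg_of_pos (hα i) (hε n)) (hD n)) (by
      rw [← Finset.sum_div, Finset.sum_add_distrib, hs, div_eq_one_iff_eq (hD n).ne']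
      simp)
  have hmem : ∀ n, q n ∈ Icc (fun _ => ρ 0) (fun _ => ρ (Fin.last N) + N) := by
    intro n
    constructor
    · intro i
      have h := (h1 n i).1
      have h' := hρ (Fin.zero_le i.castSucc)
      have : 0 ≤ ε n * ((i.castSucc : Fin (N + 1)) : ℕ) := mul_nonneg (hε n).le (Nat.cast_nonneg _)
      linarith
    · intro i
      have h := (h1 n i).2
      have h' := hρ (Fin.le_last i.succ)
      have h3 : ((i.succ : ℕ) : ℝ) ≤ N := by exact_mod_cast (Nat.succ_le_of_lt i.2 : (i.succ : ℕ) ≤ N)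
      have : ε n * ((i.succ : Fin (N + 1)) : ℕ) ≤ 1 * N :=
        mul_le_mul (hε1 n) h3 (Nat.cast_nonneg _) zero_le_one
      simp only at h ⊢
      linarith
  obtain ⟨p, -, φ, hφ, ht⟩ := isCompact_Icc.tendsto_subseq hmem
  have hε0 : Tendsto (fun n => ε (φ n)) atTop (𝓝 0) :=
    tendsto_one_div_add_atTop_nhds_zero_nat.comp hφ.tendsto_atTop
  have hρt : Tendsto (fun n => fun i : Fin (N + 1) => ρ i + ε (φ n) * (i : ℕ)) atTop (𝓝 ρ) := by
    rw [tendsto_pi_nhds]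
    intro i
    simpa using (hε0.mul_const ((i : ℕ) : ℝ)).const_add (ρ i)
  have hαt : Tendsto (fun n => fun i : Fin (N + 1) =>
      (α i + ε (φ n)) / (1 + ((N : ℝ) + 1) * ε (φ n))) atTop (𝓝 α) := by
    rw [tendsto_pi_nhds]
    intro i
    have := (hε0.const_add (α i)).div ((hε0.const_mul ((N : ℝ) + 1)).const_add 1) (by simp)
    simp only [mul_zero, add_zero, div_one] at this
    exact this
  refine ⟨p, fun i => ⟨?_, ?_⟩, Polynomial.funext fun t => ?_⟩
  · exact le_of_tendsto_of_tendsto' (tendsto_pi_nhds.1 hρt _) (tendsto_pi_nhds.1 ht i)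
      fun n => (h1 (φ n) i).1
  · exact le_of_tendsto_of_tendsto' (tendsto_pi_nhds.1 ht i) (tendsto_pi_nhds.1 hρt _)
      fun n => (h1 (φ n) i).2
  · have hl := ((continuous_eval_nodeSum t).tendsto (ρ, α)).comp (hρt.prodMk_nhds hαt)
    have hr : Tendsto (fun n => (∏ i, (X - C (q (φ n) i))).eval t) atTop
        (𝓝 ((∏ i, (X - C (p i))).eval t)) := by
      simp only [eval_prod, eval_sub, eval_X, eval_C]
      exact tendsto_finsetProd _ fun i _ => tendsto_const_nhds.sub (tendsto_pi_nhds.1 ht i)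
    refine tendsto_nhds_unique hl (hr.congr fun n => ?_)
    simp only [Function.comp]
    rw [← h2]

theorem Interlaces.monotone {ρ : Fin (N + 1) → ℝ} {q : Fin N → ℝ} (hρ : Monotone ρ)
    (h : Interlaces ρ q) : Monotone q := by
  intro i j hij
  rcases hij.eq_or_lt with rfl | hij
  · exact le_rfl
  · exact (h i).2.trans ((hρ (Fin.succ_le_castSucc_iff.2 hij)).trans (h j).1)

end Interlacing

/-! ### The Neumann system on the sphere -/

section Neumann

variable {ι : Type*} [Fintype ι]

/-- The Lagrange multiplier of the Neumann system. -/
noncomputable def neumannMultiplier (m₀ : ℝ) (ρ : ι → ℝ) (z : (ι → ℝ) × (ι → ℝ)) : ℝ :=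
  ∑ i, ρ i * z.1 i ^ 2 - 2 * m₀ * ∑ i, z.2 i ^ 2

/-- The vector field of the Neumann system. -/
noncomputable def neumannField (m₀ : ℝ) (ρ : ι → ℝ) (z : (ι → ℝ) × (ι → ℝ)) :
    (ι → ℝ) × (ι → ℝ) :=
  (z.2, fun i => (2 * m₀)⁻¹ * ((neumannMultiplier m₀ ρ z - ρ i) * z.1 i))

theorem contDiff_neumannMultiplier (m₀ : ℝ) (ρ : ι → ℝ) :
    ContDiff ℝ ∞ (neumannMultiplier m₀ ρ) := by
  unfold neumannMultiplier
  fun_prop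

theorem contDiff_neumannField (m₀ : ℝ) (ρ : ι → ℝ) : ContDiff ℝ ∞ (neumannField m₀ ρ) := by
  have := contDiff_neumannMultiplier m₀ ρ
  unfold neumannField
  fun_prop

/-- The multiplier is chosen so that half the second derivative of ∑ y_i² is a multiple of the
constraint ∑ y_i² − 1, hence zero on the sphere. -/
theorem neumann_sum_acceleration {m₀ : ℝ} (hm₀ : m₀ ≠ 0) (ρ : ι → ℝ) (z : (ι → ℝ) × (ι → ℝ)) :
    ∑ i, (z.2 i ^ 2 + z.1 i * (neumannField m₀ ρ z).2 i)
      = (2 * m₀)⁻¹ * (neumannMultiplier m₀ ρ z * (∑ i, z.1 i ^ 2 - 1)) := by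
  have h1 : ∑ i, z.1 i * (neumannField m₀ ρ z).2 i = (2 * m₀)⁻¹ *
      (neumannMultiplier m₀ ρ z * ∑ i, z.1 i ^ 2 - ∑ i, ρ i * z.1 i ^ 2) := by
    rw [Finset.mul_sum, ← Finset.sum_sub_distrib, Finset.mul_sum]
    refine Finset.sum_congr rfl fun i _ => ?_
    simp only [neumannField]
    ring
  have h2 : ∑ i, ρ i * z.1 i ^ 2 = neumannMultiplier m₀ ρ z + 2 * m₀ * ∑ i, z.2 i ^ 2 := by
    simp only [neumannMultiplier]
    ring
  rw [Finset.sum_add_distrib, h1, h2]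
  field_simp
  ring

/-- On the tangent bundle of the unit sphere the Neumann system has global smooth solutions,
which stay there and conserve the energy. -/
theorem exists_neumann_flow {m₀ : ℝ} (hm₀ : 0 < m₀) (ρ : ι → ℝ) (z₀ : (ι → ℝ) × (ι → ℝ))
    (h1 : ∑ i, z₀.1 i ^ 2 = 1) (h2 : ∑ i, z₀.1 i * z₀.2 i = 0) :
    ∃ z : ℝ → (ι → ℝ) × (ι → ℝ), z 0 = z₀ ∧ ContDiff ℝ ∞ z ∧
      (∀ x, HasDerivAt z (neumannField m₀ ρ (z x)) x) ∧
      (∀ x, ∑ i, (z x).1 i ^ 2 = 1) ∧ (∀ x, ∑ i, (z x).1 i * (z x).2 i = 0) ∧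
      ∀ x, ∑ i, ρ i * (z x).1 i ^ 2 + 2 * m₀ * ∑ i, (z x).2 i ^ 2
        = ∑ i, ρ i * z₀.1 i ^ 2 + 2 * m₀ * ∑ i, z₀.2 i ^ 2 := by
  set E₀ := ∑ i, ρ i * z₀.1 i ^ 2 + 2 * m₀ * ∑ i, z₀.2 i ^ 2 with hE₀
  -- On the sphere, conservation of energy gives 2 m₀ ∑ v_i² ≤ |E₀| + ∑ |ρ_i|, so `B` bounds every
  -- v_i².
  set B := (|E₀| + ∑ i, |ρ i|) / (2 * m₀) with hB
  have hB0 : 0 ≤ B := by positivity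
  -- The field is cut off outside the ball of radius 1 + B, which the orbit turns out never to
  -- leave.
  let χ : ContDiffBump (0 : (ι → ℝ) × (ι → ℝ)) := ⟨1 + B, 2 + B, by positivity, by linarith⟩
  have hχ : ContDiff ℝ ∞ χ := χ.contDiff
  have hV := contDiff_neumannField m₀ ρ
  have hφ := contDiff_neumannMultiplier m₀ ρ
  obtain ⟨z, hz0, hz⟩ := exists_global_of_hasCompactSupport
    (F := fun p => χ p • neumannField m₀ ρ p) ((hχ.smul hV).of_le (by exact_mod_cast le_top))
    χ.hasCompactSupport.smul_right z₀
  have hy : ∀ x i, HasDerivAt (fun x => (z x).1 i) (χ (z x) * (z x).2 i) x := fun x i =>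
    hasDerivAt_pi.1 (hasFDerivAt_fst.comp_hasDerivAt x (hz x)) i
  have hv : ∀ x i, HasDerivAt (fun x => (z x).2 i)
      (χ (z x) * (neumannField m₀ ρ (z x)).2 i) x := fun x i =>
    hasDerivAt_pi.1 (hasFDerivAt_snd.comp_hasDerivAt x (hz x)) i
  have hg : ∀ x, HasDerivAt (fun x => ∑ i, (z x).1 i ^ 2 - 1)
      (2 * χ (z x) * ∑ i, (z x).1 i * (z x).2 i) x := by
    intro x
    refine ((HasDerivAt.fun_sum fun i _ => (hy x i).pow 2).sub_const 1).congr_deriv ?_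
    rw [Finset.mul_sum]
    refine Finset.sum_congr rfl fun i _ => ?_
    push_cast
    ring
  have hh : ∀ x, HasDerivAt (fun x => ∑ i, (z x).1 i * (z x).2 i)
      (χ (z x) * (2 * m₀)⁻¹ * neumannMultiplier m₀ ρ (z x) * (∑ i, (z x).1 i ^ 2 - 1)) x := by
    intro x
    refine (HasDerivAt.fun_sum fun i _ => (hy x i).mul (hv x i)).congr_deriv ?_
    rw [mul_assoc, mul_assoc, ← neumann_sum_acceleration hm₀.ne', Finset.mul_sum]
    refine Finset.sum_congr rfl fun i _ => ?_
    ring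
  -- Along the cut-off flow the two constraint functions solve a linear homogeneous system.
  -- Uniqueness for the enlarged system compares them with zero.
  have hzero : ∀ x, ∑ i, (z x).1 i ^ 2 - 1 = 0 ∧ ∑ i, (z x).1 i * (z x).2 i = 0 := by
    let F : ((ι → ℝ) × (ι → ℝ)) × ℝ × ℝ → ((ι → ℝ) × (ι → ℝ)) × ℝ × ℝ := fun p =>
      (χ p.1 • neumannField m₀ ρ p.1, 2 * χ p.1 * p.2.2,
        χ p.1 * (2 * m₀)⁻¹ * neumannMultiplier m₀ ρ p.1 * p.2.1)
    have hF : ContDiff ℝ 1 F := by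
      have hχ1 : ContDiff ℝ 1 χ := χ.contDiff
      have hV1 : ContDiff ℝ 1 (neumannField m₀ ρ) := hV.of_le (by exact_mod_cast le_top)
      have hφ1 : ContDiff ℝ 1 (neumannMultiplier m₀ ρ) := hφ.of_le (by exact_mod_cast le_top)
      have a1 : ContDiff ℝ 1 fun p : ((ι → ℝ) × (ι → ℝ)) × ℝ × ℝ => χ p.1 :=
        hχ1.comp contDiff_fst
      have a2 : ContDiff ℝ 1 fun p : ((ι → ℝ) × (ι → ℝ)) × ℝ × ℝ => neumannField m₀ ρ p.1 :=
        hV1.comp contDiff_fst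
      have a3 : ContDiff ℝ 1 fun p : ((ι → ℝ) × (ι → ℝ)) × ℝ × ℝ => neumannMultiplier m₀ ρ p.1 :=
        hφ1.comp contDiff_fst
      exact (a1.smul a2).prodMk (((contDiff_const.mul a1).mul (by fun_prop)).prodMk
        (((a1.mul contDiff_const).mul a3).mul (by fun_prop)))
    have hE := eqOn_of_hasDerivAt_field hF ordConnected_univ (t₀ := 0) (mem_univ _)
      (f := fun x => (z x, ∑ i, (z x).1 i ^ 2 - 1, ∑ i, (z x).1 i * (z x).2 i))
      (g := fun x => (z x, 0, 0))
      (fun x _ => (hz x).prodMk ((hg x).prodMk (hh x)))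
      (fun x _ => ((hz x).prodMk ((hasDerivAt_const x (0 : ℝ)).prodMk
        (hasDerivAt_const x (0 : ℝ)))).congr_deriv (by simp [F]))
      (by simp [hz0, h1, h2])
    intro x
    have := hE (mem_univ x)
    simp only [Prod.mk.injEq, true_and] at this
    exact this
  have hen : ∀ x, ∑ i, ρ i * (z x).1 i ^ 2 + 2 * m₀ * ∑ i, (z x).2 i ^ 2 = E₀ := by
    have hd : ∀ x, HasDerivAt (fun x => ∑ i, ρ i * (z x).1 i ^ 2 + 2 * m₀ * ∑ i, (z x).2 i ^ 2)
        0 x := by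
      intro x
      refine ((HasDerivAt.fun_sum fun i _ => ((hy x i).pow 2).const_mul (ρ i)).add
        ((HasDerivAt.fun_sum fun i _ => (hv x i).pow 2).const_mul (2 * m₀))).congr_deriv ?_
      -- The derivative of the energy is a multiple of ∑ y_i v_i, which vanishes.
      have h0 := (hzero x).2
      have : 2 * χ (z x) * neumannMultiplier m₀ ρ (z x) * ∑ i, (z x).1 i * (z x).2 i = 0 := by
        rw [h0, mul_zero]
      rw [← this, Finset.mul_sum, Finset.mul_sum, ← Finset.sum_add_distrib]
      refine Finset.sum_congr rfl fun i _ => ?_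
      simp only [neumannField]
      push_cast
      field_simp
      ring
    intro x
    have := is_const_of_deriv_eq_zero (fun x => (hd x).differentiableAt) (fun x => (hd x).deriv) x 0
    rw [this, hz0]
  have hbound : ∀ x, ‖z x‖ ≤ 1 + B := by
    intro x
    have hs : ∑ i, (z x).1 i ^ 2 = 1 := by linarith [(hzero x).1]
    have hle : ∀ i, (z x).1 i ^ 2 ≤ 1 := fun i => by
      rw [← hs]
      exact Finset.single_le_sum (f := fun i => (z x).1 i ^ 2) (fun i _ => sq_nonneg _)
        (Finset.mem_univ i)
    have hle2 : ∀ i, (z x).2 i ^ 2 ≤ B := by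
      intro i
      refine (Finset.single_le_sum (f := fun i => (z x).2 i ^ 2) (fun i _ => sq_nonneg _)
        (Finset.mem_univ i)).trans ?_
      rw [hB, le_div_iff₀ (by positivity)]
      have e1 : -∑ i, |ρ i| ≤ ∑ i, ρ i * (z x).1 i ^ 2 := by
        rw [← Finset.sum_neg_distrib]
        refine Finset.sum_le_sum fun i _ => ?_
        have := mul_le_mul_of_nonneg_left (hle i) (abs_nonneg (ρ i))
        have := mul_le_mul_of_nonneg_right (neg_abs_le (ρ i)) (sq_nonneg ((z x).1 i))
        linarith
      have := hen x
      have := le_abs_self E₀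
      linarith
    rw [norm_prod_le_iff, pi_norm_le_iff_of_nonneg (by positivity),
      pi_norm_le_iff_of_nonneg (by positivity)]
    refine ⟨fun i => ?_, fun i => ?_⟩
    · rw [Real.norm_eq_abs]
      have := (sq_le_one_iff_abs_le_one _).1 (hle i)
      linarith
    · rw [Real.norm_eq_abs]
      exact abs_le_of_sq_le_sq ((hle2 i).trans (by nlinarith)) (by positivity)
  have hz' : ∀ x, HasDerivAt z (neumannField m₀ ρ (z x)) x := by
    intro x
    have : χ (z x) = 1 := χ.one_of_mem_closedBall (by simpa using hbound x)
    simpa [this] using hz x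
  exact ⟨z, hz0, contDiff_of_hasDerivAt_field hV hz', hz', fun x => by linarith [(hzero x).1],
    fun x => (hzero x).2, hen⟩

end Neumann

/-! ### From Neumann trajectories to solutions of the base system -/

section NeumannToBase

variable {N : ℕ}

theorem coeff_nodeSum_eq_sum (ρ α : Fin (N + 1) → ℝ) (n : ℕ) :
    (nodeSum ρ α).coeff n = ∑ i, α i * (nodePoly ρ i).coeff n := by
  simp [nodeSum, finsetSum_coeff]

theorem HasDerivAt.lowCoeffs_nodeSum (ρ : Fin (N + 1) → ℝ) {α : ℝ → Fin (N + 1) → ℝ}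
    {α' : Fin (N + 1) → ℝ} {x : ℝ} (h : ∀ i, HasDerivAt (fun x => α x i) (α' i) x) :
    HasDerivAt (fun x => lowCoeffs N (nodeSum ρ (α x))) (lowCoeffs N (nodeSum ρ α')) x := by
  rw [hasDerivAt_pi]
  intro k
  simp only [lowCoeffs, coeff_nodeSum_eq_sum]
  exact HasDerivAt.fun_sum fun i _ => (h i).mul_const _

theorem contDiff_lowCoeffs_nodeSum (ρ : Fin (N + 1) → ℝ) {α : ℝ → Fin (N + 1) → ℝ}
    (h : ∀ i, ContDiff ℝ ∞ fun x => α x i) :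
    ContDiff ℝ ∞ fun x => lowCoeffs N (nodeSum ρ (α x)) := by
  rw [contDiff_pi]
  intro k
  simp only [lowCoeffs, coeff_nodeSum_eq_sum]
  exact ContDiff.sum fun i _ => (h i).mul contDiff_const

theorem coeff_pred_nodeSum [NeZero N] (ρ : Fin (N + 1) → ℝ) {α : Fin (N + 1) → ℝ}
    (h : ∑ i, α i = 1) :
    (nodeSum ρ α).coeff (N - 1) = (∏ j, (X - C (ρ j))).coeff N + ∑ i, ρ i * α i := by
  have hN : N - 1 + 1 = N := Nat.sub_add_cancel (NeZero.one_le)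
  rw [← coeff_X_mul, hN, X_mul_nodeSum, h, C_1, one_mul, coeff_add, coeff_nodeSum]

/-- The polynomial whose coefficients are the Uhlenbeck integrals of the Neumann system. -/
noncomputable def spectralPoly (m₀ : ℝ) (ρ : Fin (N + 1) → ℝ)
    (z : (Fin (N + 1) → ℝ) × (Fin (N + 1) → ℝ)) : ℝ[X] :=
  nodeSum ρ (fun i => z.1 i ^ 2) *
      (∏ j, (X - C (ρ j)) + C (2 * m₀) * nodeSum ρ (fun i => z.2 i ^ 2))
    - C (2 * m₀) * nodeSum ρ (fun i => z.1 i * z.2 i) ^ 2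

/-- At fixed μ = t, the sums S, A, K of y_i², y_i v_i, v_i² weighted by node polynomials satisfy a
closed system, thanks to ρ_i p_i = t p_i − R. In the derivative of S (R + 2 m₀ K) − 2 m₀ A² all
terms cancel. -/
theorem spectralPoly_const {m₀ : ℝ} (hm₀ : m₀ ≠ 0) (ρ : Fin (N + 1) → ℝ)
    {z : ℝ → (Fin (N + 1) → ℝ) × (Fin (N + 1) → ℝ)}
    (hz : ∀ x, HasDerivAt z (neumannField m₀ ρ (z x)) x)
    (h1 : ∀ x, ∑ i, (z x).1 i ^ 2 = 1) (h2 : ∀ x, ∑ i, (z x).1 i * (z x).2 i = 0) (x : ℝ) :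
    spectralPoly m₀ ρ (z x) = spectralPoly m₀ ρ (z 0) := by
  refine Polynomial.funext fun t => ?_
  set p : Fin (N + 1) → ℝ := fun i => (nodePoly ρ i).eval t
  set R : ℝ := (∏ j, (X - C (ρ j))).eval t with hR
  have hp : ∀ i, ρ i * p i = t * p i - R := by
    intro i
    have := congrArg (eval t) (X_sub_C_mul_nodePoly ρ i)
    simp only [eval_mul, eval_sub, eval_X, eval_C] at this
    rw [hR, ← this]
    ring
  have hy : ∀ x i, HasDerivAt (fun x => (z x).1 i) ((z x).2 i) x := fun x i =>
    hasDerivAt_pi.1 (hasFDerivAt_fst.comp_hasDerivAt x (hz x)) i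
  have hv : ∀ x i, HasDerivAt (fun x => (z x).2 i) ((neumannField m₀ ρ (z x)).2 i) x := fun x i =>
    hasDerivAt_pi.1 (hasFDerivAt_snd.comp_hasDerivAt x (hz x)) i
  let φ : ℝ → ℝ := fun x => neumannMultiplier m₀ ρ (z x)
  let S : ℝ → ℝ := fun x => ∑ i, (z x).1 i ^ 2 * p i
  let A : ℝ → ℝ := fun x => ∑ i, (z x).1 i * (z x).2 i * p i
  let K : ℝ → ℝ := fun x => ∑ i, (z x).2 i ^ 2 * p i
  have hS : ∀ x, HasDerivAt S (2 * A x) x := by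
    intro x
    refine (HasDerivAt.fun_sum fun i _ => ((hy x i).pow 2).mul_const (p i)).congr_deriv ?_
    rw [Finset.mul_sum]
    exact Finset.sum_congr rfl fun i _ => by push_cast; ring
  have hρS : ∀ x, ∑ i, ρ i * (z x).1 i ^ 2 * p i = t * S x - R := by
    intro x
    have e : t * S x - R = t * S x - (∑ i, (z x).1 i ^ 2) * R := by rw [h1, one_mul]
    rw [e, Finset.mul_sum, Finset.sum_mul, ← Finset.sum_sub_distrib]
    exact Finset.sum_congr rfl fun i _ => by linear_combination (z x).1 i ^ 2 * hp i
  have hρA : ∀ x, ∑ i, ρ i * ((z x).1 i * (z x).2 i) * p i = t * A x := by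
    intro x
    have e : t * A x = t * A x - (∑ i, (z x).1 i * (z x).2 i) * R := by rw [h2, zero_mul, sub_zero]
    rw [e, Finset.mul_sum, Finset.sum_mul, ← Finset.sum_sub_distrib]
    exact Finset.sum_congr rfl fun i _ => by linear_combination (z x).1 i * (z x).2 i * hp i
  have hK : ∀ x, HasDerivAt K (m₀⁻¹ * ((φ x - t) * A x)) x := by
    intro x
    refine (HasDerivAt.fun_sum fun i _ => ((hv x i).pow 2).mul_const (p i)).congr_deriv ?_
    rw [sub_mul, ← hρA, Finset.mul_sum, ← Finset.sum_sub_distrib, Finset.mul_sum]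
    refine Finset.sum_congr rfl fun i _ => ?_
    simp only [neumannField, φ]
    push_cast
    field_simp
  have hA : ∀ x, HasDerivAt A (K x + (2 * m₀)⁻¹ * ((φ x - t) * S x + R)) x := by
    intro x
    refine (HasDerivAt.fun_sum fun i _ => ((hy x i).mul (hv x i)).mul_const (p i)).congr_deriv ?_
    have e : (φ x - t) * S x + R = φ x * S x - (t * S x - R) := by ring
    rw [e, ← hρS, Finset.mul_sum, ← Finset.sum_sub_distrib, Finset.mul_sum,
      ← Finset.sum_add_distrib]
    refine Finset.sum_congr rfl fun i _ => ?_
    simp only [neumannField, φ]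
    ring
  have hG : ∀ x, HasDerivAt (fun x => S x * (R + 2 * m₀ * K x) - 2 * m₀ * A x ^ 2) 0 x := by
    intro x
    refine (((hS x).mul (((hK x).const_mul (2 * m₀)).const_add R)).sub
      (((hA x).pow 2).const_mul (2 * m₀))).congr_deriv ?_
    push_cast
    field_simp
    ring
  have hev : ∀ x, (spectralPoly m₀ ρ (z x)).eval t
      = S x * (R + 2 * m₀ * K x) - 2 * m₀ * A x ^ 2 := by
    intro x
    simp only [spectralPoly, eval_sub, eval_mul, eval_add, eval_pow, eval_nodeSum, eval_C, S, K, A,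
      R, p]
  rw [hev, hev]
  exact is_const_of_deriv_eq_zero (fun x => (hG x).differentiableAt) (fun x => (hG x).deriv) x 0

/-- A point of the tangent bundle of the sphere on the correct level of the Uhlenbeck integrals
determines a global smooth solution of the base system. -/
theorem exists_global_baseSolution [NeZero N] {m₀ : ℝ} (hm₀ : 0 < m₀) (c : Fin (2 * N) → ℝ)
    (ρ : Fin (N + 1) → ℝ) (z₀ : (Fin (N + 1) → ℝ) × (Fin (N + 1) → ℝ))
    (h1 : ∑ i, z₀.1 i ^ 2 = 1) (h2 : ∑ i, z₀.1 i * z₀.2 i = 0) (w₀ : Fin N → ℝ)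
    (hw₀ : wPoly w₀ = nodeSum ρ fun i => z₀.1 i ^ 2)
    (hφ : neumannMultiplier m₀ ρ z₀ = 2 * w₀ 0) (hG : basePoly c = spectralPoly m₀ ρ z₀) :
    ∃ W : ℝ → Fin N → ℝ, ContDiff ℝ ∞ W ∧ IsBaseSolutionOn m₀ c univ W ∧ W 0 = w₀ ∧
      lowPoly (deriv W 0) = C 2 * nodeSum ρ (fun i => z₀.1 i * z₀.2 i) ∧
      ∀ x, ∃ α : Fin (N + 1) → ℝ, (∀ i, 0 ≤ α i) ∧ ∑ i, α i = 1 ∧ wPoly (W x) = nodeSum ρ α := by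
  obtain ⟨z, hz0, hzs, hz, hz1, hz2, hz3⟩ := exists_neumann_flow hm₀ ρ z₀ h1 h2
  have hy : ∀ x i, HasDerivAt (fun x => (z x).1 i) ((z x).2 i) x := fun x i =>
    hasDerivAt_pi.1 (hasFDerivAt_fst.comp_hasDerivAt x (hz x)) i
  have hv : ∀ x i, HasDerivAt (fun x => (z x).2 i) ((neumannField m₀ ρ (z x)).2 i) x := fun x i =>
    hasDerivAt_pi.1 (hasFDerivAt_snd.comp_hasDerivAt x (hz x)) i
  let W : ℝ → Fin N → ℝ := fun x => lowCoeffs N (nodeSum ρ fun i => (z x).1 i ^ 2)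
  have hWp : ∀ x, wPoly (W x) = nodeSum ρ fun i => (z x).1 i ^ 2 := fun x =>
    wPoly_lowCoeffs (nodeSum_monic (hz1 x)) (natDegree_nodeSum (hz1 x))
  have hW1 : ∀ x, HasDerivAt W
      (lowCoeffs N (nodeSum ρ fun i => 2 * ((z x).1 i * (z x).2 i))) x := by
    intro x
    refine HasDerivAt.lowCoeffs_nodeSum ρ fun i => ((hy x i).pow 2).congr_deriv ?_
    push_cast
    ring
  have hdW : deriv W = fun x => lowCoeffs N (nodeSum ρ fun i => 2 * ((z x).1 i * (z x).2 i)) :=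
    funext fun x => (hW1 x).deriv
  have hW2 : ∀ x, HasDerivAt (deriv W) (lowCoeffs N (nodeSum ρ fun i =>
      2 * ((z x).2 i ^ 2 + (z x).1 i * (neumannField m₀ ρ (z x)).2 i))) x := by
    intro x
    rw [hdW]
    refine HasDerivAt.lowCoeffs_nodeSum ρ fun i =>
      (((hy x i).mul (hv x i)).const_mul 2).congr_deriv ?_
    ring
  have hL1 : ∀ x, lowPoly (deriv W x) = C 2 * nodeSum ρ (fun i => (z x).1 i * (z x).2 i) := by
    intro x
    rw [hdW, lowPoly_lowCoeffs, nodeSum_smul]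
    refine degree_nodeSum_lt_of_sum_eq_zero ?_
    rw [← Finset.mul_sum, hz2, mul_zero]
  -- This is the Neumann equation rewritten for w_xx; the products ρ_i y_i² are absorbed by
  -- `X_mul_nodeSum`.
  have hL2 : ∀ x, C m₀ * lowPoly (deriv (deriv W) x) =
      C (2 * m₀) * nodeSum ρ (fun i => (z x).2 i ^ 2)
        + (C (neumannMultiplier m₀ ρ (z x)) - X) * nodeSum ρ (fun i => (z x).1 i ^ 2)
        + ∏ j, (X - C (ρ j)) := by
    intro x
    rw [(hW2 x).deriv, lowPoly_lowCoeffs]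
    · rw [sub_mul, X_mul_nodeSum, hz1, C_1, one_mul, ← nodeSum_smul, ← nodeSum_smul,
        ← nodeSum_smul]
      have : (nodeSum ρ fun i => m₀ * (2 * ((z x).2 i ^ 2 +
          (z x).1 i * (neumannField m₀ ρ (z x)).2 i))) +
            (nodeSum ρ fun i => ρ i * (z x).1 i ^ 2) =
          (nodeSum ρ fun i => 2 * m₀ * (z x).2 i ^ 2) +
            nodeSum ρ fun i => neumannMultiplier m₀ ρ (z x) * (z x).1 i ^ 2 := by
        rw [← nodeSum_add, ← nodeSum_add]
        congr 1
        funext i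
        simp only [neumannField]
        field_simp
        ring
      linear_combination this
    · refine degree_nodeSum_lt_of_sum_eq_zero ?_
      rw [← Finset.mul_sum, neumann_sum_acceleration hm₀.ne', hz1]
      simp
  have hW0 : W 0 = w₀ := by
    refine lowPoly_injective ?_
    have := hWp 0
    rw [hz0, ← hw₀] at this
    exact add_left_cancel this
  -- Here w_1 is a constant plus ∑ ρ_i y_i², and the multiplier is 2 ∑ ρ_i y_i² minus the energy. So
  -- multiplier − 2 w_1 is constant, and it vanishes at 0.
  have hWφ : ∀ x, neumannMultiplier m₀ ρ (z x) = 2 * W x 0 := by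
    have hN : ∀ x, W x 0 = (∏ j, (X - C (ρ j))).coeff N + ∑ i, ρ i * (z x).1 i ^ 2 := fun x => by
      rw [← coeff_pred_nodeSum ρ (hz1 x)]
      simp [W, lowCoeffs]
    intro x
    have e1 := hz3 x
    have e2 := hN 0
    rw [hW0, hz0] at e2
    rw [hN]
    simp only [neumannMultiplier] at hφ ⊢
    linarith
  refine ⟨W, contDiff_lowCoeffs_nodeSum ρ fun i => ?_, fun x _ => ⟨(hW1 x).differentiableAt,
    (hW2 x).differentiableAt, ?_⟩, hW0, by rw [hL1, hz0], fun x =>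
    ⟨_, fun i => sq_nonneg _, hz1 x, hWp x⟩⟩
  · exact (contDiff_pi.1 (contDiff_fst.comp hzs) i).pow 2
  · rw [hG, ← hz0, ← spectralPoly_const hm₀.ne' ρ hz hz1 hz2 x, ← hWφ, hWp, hL1, spectralPoly]
    have e : (C (1 / 2) : ℝ[X]) * C 2 ^ 2 = C 2 := by
      rw [← C_pow, ← C_mul]; norm_num
    have e2 : (C (2 * m₀) : ℝ[X]) = C 2 * C m₀ := C_mul
    linear_combination (-(nodeSum ρ fun i => (z x).1 i ^ 2)) * hL2 x
      + C m₀ * (nodeSum ρ fun i => (z x).1 i * (z x).2 i) ^ 2 * e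
      - (nodeSum ρ fun i => (z x).1 i * (z x).2 i) ^ 2 * e2

end NeumannToBase

/-! ### Repeated nodes and the common factor -/

section Nodes

variable {N : ℕ}

theorem nodePoly_congr (ρ : Fin (N + 1) → ℝ) {i j : Fin (N + 1)} (h : ρ i = ρ j) :
    nodePoly ρ i = nodePoly ρ j := by
  have e := (X_sub_C_mul_nodePoly ρ i).trans (X_sub_C_mul_nodePoly ρ j).symm
  rw [h] at e
  exact mul_left_cancel₀ (X_sub_C_ne_zero _) e

/-- One index for each value of `ρ`. -/
noncomputable def nodeReps (ρ : Fin (N + 1) → ℝ) : Finset (Fin (N + 1)) :=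
  Finset.univ.filter fun i => Function.invFun ρ (ρ i) = i

theorem apply_invFun_apply (ρ : Fin (N + 1) → ℝ) (i : Fin (N + 1)) :
    ρ (Function.invFun ρ (ρ i)) = ρ i :=
  Function.invFun_eq ⟨i, rfl⟩

theorem invFun_apply_mem_nodeReps (ρ : Fin (N + 1) → ℝ) (i : Fin (N + 1)) :
    Function.invFun ρ (ρ i) ∈ nodeReps ρ := by
  rw [nodeReps, Finset.mem_filter, apply_invFun_apply ρ]
  exact ⟨Finset.mem_univ _, rfl⟩

theorem injOn_nodeReps (ρ : Fin (N + 1) → ℝ) : InjOn ρ (nodeReps ρ) := by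
  intro i hi j hj h
  simp only [nodeReps, Finset.coe_filter, Finset.mem_univ, true_and, mem_ofPred_eq] at hi hj
  rw [← hi, h, hj]

/-- Equal nodes have equal node polynomials, so their weights can be added up at one representative.
-/
theorem exists_nodeSum_reps (ρ : Fin (N + 1) → ℝ) {α : Fin (N + 1) → ℝ} (hα : ∀ i, 0 ≤ α i) :
    ∃ β : Fin (N + 1) → ℝ, (∀ i, 0 ≤ β i) ∧ (∀ i ∉ nodeReps ρ, β i = 0) ∧
      nodeSum ρ α = nodeSum ρ β := by
  classical
  refine ⟨fun i => ∑ j with Function.invFun ρ (ρ j) = i, α j,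
    fun i => Finset.sum_nonneg fun j _ => hα j, fun i hi => ?_, ?_⟩
  · beta_reduce
    rw [Finset.filter_false_of_mem, Finset.sum_empty]
    rintro j - rfl
    exact hi (invFun_apply_mem_nodeReps ρ j)
  · simp only [nodeSum, map_sum, Finset.sum_mul]
    rw [← Finset.sum_fiberwise Finset.univ (fun j => Function.invFun ρ (ρ j))]
    refine Finset.sum_congr rfl fun i _ => Finset.sum_congr rfl fun j hj => ?_
    rw [Finset.mem_filter] at hj
    rw [nodePoly_congr ρ (i := i) (j := j) (by rw [← hj.2, apply_invFun_apply ρ])]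

/-- The common factor of the node polynomials. -/
noncomputable def commonPoly (ρ : Fin (N + 1) → ℝ) : ℝ[X] :=
  ∏ j ∈ (nodeReps ρ)ᶜ, (X - C (ρ j))

theorem commonPoly_monic (ρ : Fin (N + 1) → ℝ) : (commonPoly ρ).Monic :=
  monic_prod_of_monic _ _ fun _ _ => monic_X_sub_C _

/-- The product of `X - t` over the values `t` of `ρ`. -/
noncomputable def reducedProd (ρ : Fin (N + 1) → ℝ) : ℝ[X] := ∏ j ∈ nodeReps ρ, (X - C (ρ j))

/-- The node polynomials, divided by their common factor. -/
noncomputable def reducedNode (ρ : Fin (N + 1) → ℝ) (i : Fin (N + 1)) : ℝ[X] :=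
  ∏ j ∈ (nodeReps ρ).erase i, (X - C (ρ j))

theorem prod_eq_common_mul_reduced (ρ : Fin (N + 1) → ℝ) :
    ∏ j, (X - C (ρ j)) = commonPoly ρ * reducedProd ρ :=
  (Finset.prod_compl_mul_prod _ _).symm

theorem reducedProd_eq {ρ : Fin (N + 1) → ℝ} {i : Fin (N + 1)} (hi : i ∈ nodeReps ρ) :
    reducedProd ρ = (X - C (ρ i)) * reducedNode ρ i :=
  (Finset.mul_prod_erase _ _ hi).symm

theorem nodePoly_eq_common_mul {ρ : Fin (N + 1) → ℝ} {i : Fin (N + 1)} (hi : i ∈ nodeReps ρ) :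
    nodePoly ρ i = commonPoly ρ * reducedNode ρ i := by
  refine mul_left_cancel₀ (X_sub_C_ne_zero (ρ i)) ?_
  rw [X_sub_C_mul_nodePoly, prod_eq_common_mul_reduced, reducedProd_eq hi]
  ring

theorem eval_reducedNode_self_ne_zero {ρ : Fin (N + 1) → ℝ} {i : Fin (N + 1)}
    (hi : i ∈ nodeReps ρ) : (reducedNode ρ i).eval (ρ i) ≠ 0 := by
  rw [reducedNode, eval_prod, Finset.prod_ne_zero_iff]
  intro j hj
  rw [eval_sub, eval_X, eval_C, sub_ne_zero]
  intro h
  rw [Finset.mem_erase] at hj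
  exact hj.1 (injOn_nodeReps ρ hj.2 hi h.symm)

theorem eval_reducedProd {ρ : Fin (N + 1) → ℝ} {i : Fin (N + 1)} (hi : i ∈ nodeReps ρ) :
    (reducedProd ρ).eval (ρ i) = 0 := by
  rw [reducedProd_eq hi]
  simp

/-- The combination `nodeSum`, divided by the common factor of the node polynomials. -/
noncomputable def reducedSum (ρ α : Fin (N + 1) → ℝ) : ℝ[X] :=
  ∑ i ∈ nodeReps ρ, C (α i) * reducedNode ρ i

theorem eval_reducedSum (ρ α : Fin (N + 1) → ℝ) {i : Fin (N + 1)} (hi : i ∈ nodeReps ρ) :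
    (reducedSum ρ α).eval (ρ i) = α i * (reducedNode ρ i).eval (ρ i) := by
  rw [reducedSum, eval_finsetSum, Finset.sum_eq_single_of_mem i hi]
  · simp
  · intro j hj hji
    rw [eval_mul, reducedNode, eval_prod,
      Finset.prod_eq_zero (Finset.mem_erase.2 ⟨hji.symm, hi⟩) (by simp), mul_zero]

theorem nodeSum_eq_common_mul {ρ α : Fin (N + 1) → ℝ} (h : ∀ i ∉ nodeReps ρ, α i = 0) :
    nodeSum ρ α = commonPoly ρ * reducedSum ρ α := by
  rw [nodeSum, reducedSum, Finset.mul_sum, ← Finset.sum_subset (Finset.subset_univ (nodeReps ρ))]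
  · refine Finset.sum_congr rfl fun i hi => ?_
    rw [nodePoly_eq_common_mul hi]
    ring
  · intro i _ hi
    rw [h i hi, C_0, zero_mul]

/-- After division by the common factor, evaluation at `ρ i` isolates `α i`. -/
theorem eq_zero_of_nodeSum_eq_zero {ρ α : Fin (N + 1) → ℝ} (h : ∀ i ∉ nodeReps ρ, α i = 0)
    (h0 : nodeSum ρ α = 0) : α = 0 := by
  rw [nodeSum_eq_common_mul h, mul_eq_zero, or_iff_right (commonPoly_monic ρ).ne_zero] at h0
  funext i
  by_cases hi : i ∈ nodeReps ρ
  · have := eval_reducedSum ρ α hi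
    rw [h0, eval_zero, eq_comm, mul_eq_zero,
      or_iff_left (eval_reducedNode_self_ne_zero hi)] at this
    exact this
  · exact h i hi

/-- A linear choice of coefficients of combinations of the node polynomials. -/
theorem exists_nodeCoeff (ρ : Fin (N + 1) → ℝ) :
    ∃ l : ℝ[X] →ₗ[ℝ] Fin (N + 1) → ℝ, (∀ p, ∀ i ∉ nodeReps ρ, l p i = 0) ∧
      ∀ α : Fin (N + 1) → ℝ, (∀ i ∉ nodeReps ρ, α i = 0) → l (nodeSum ρ α) = α := by
  let V : Submodule ℝ (Fin (N + 1) → ℝ) :=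
    { carrier := {α | ∀ i ∉ nodeReps ρ, α i = 0}
      add_mem' := fun ha hb i hi => by simp [ha i hi, hb i hi]
      zero_mem' := fun i _ => rfl
      smul_mem' := fun c a ha i hi => by simp [ha i hi] }
  let L : V →ₗ[ℝ] ℝ[X] :=
    { toFun := fun α => nodeSum ρ α.1
      map_add' := fun a b => nodeSum_add ρ a.1 b.1
      map_smul' := fun c a => by
        rw [RingHom.id_apply, smul_eq_C_mul, ← nodeSum_smul]
        rfl }
  have hL : LinearMap.ker L = ⊥ := by
    rw [LinearMap.ker_eq_bot']
    exact fun a ha => Subtype.ext (eq_zero_of_nodeSum_eq_zero a.2 ha)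
  obtain ⟨g, hg⟩ := L.exists_leftInverse_of_injective hL
  refine ⟨V.subtype ∘ₗ g, fun p i hi => (g p).2 i hi, fun α hα => ?_⟩
  have := LinearMap.congr_fun hg ⟨α, hα⟩
  exact congrArg Subtype.val this

/-- Lagrange interpolation of the quotient at the distinct values of `ρ`. -/
theorem exists_nodeSum_of_common_dvd {ρ : Fin (N + 1) → ℝ} {p : ℝ[X]}
    (hp : p.degree < (N + 1 : ℕ)) (h : commonPoly ρ ∣ p) :
    ∃ β : Fin (N + 1) → ℝ, (∀ i ∉ nodeReps ρ, β i = 0) ∧ p = nodeSum ρ β := by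
  classical
  obtain ⟨u, rfl⟩ := h
  let β : Fin (N + 1) → ℝ := fun i =>
    if i ∈ nodeReps ρ then u.eval (ρ i) / (reducedNode ρ i).eval (ρ i) else 0
  have hβ : ∀ i ∉ nodeReps ρ, β i = 0 := fun i hi => if_neg hi
  refine ⟨β, hβ, ?_⟩
  rw [nodeSum_eq_common_mul hβ]
  congr 1
  have hdeg : ∀ v : ℝ[X], (commonPoly ρ * v).degree < (N + 1 : ℕ) →
      v.degree < (nodeReps ρ).card := by
    intro v hv
    rcases eq_or_ne v 0 with rfl | hv0
    · simp
    · have hc : (commonPoly ρ).natDegree = ((nodeReps ρ)ᶜ).card := by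
        rw [commonPoly, natDegree_finsetProd_X_sub_C_eq_card]
      have h1 := (commonPoly_monic ρ).natDegree_mul' hv0
      rw [degree_eq_natDegree (mul_ne_zero (commonPoly_monic ρ).ne_zero hv0), h1, hc] at hv
      have hv : ((nodeReps ρ)ᶜ).card + v.natDegree < N + 1 := by exact_mod_cast hv
      have h2 := Finset.card_add_card_compl (nodeReps ρ)
      rw [Fintype.card_fin] at h2
      rw [degree_eq_natDegree hv0]
      exact_mod_cast (by omega : v.natDegree < (nodeReps ρ).card)
  refine eq_of_degrees_lt_of_eval_index_eq (v := ρ) (nodeReps ρ) (injOn_nodeReps ρ) (hdeg u hp)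
    (hdeg _ ?_) ?_
  · rw [← nodeSum_eq_common_mul hβ]
    exact degree_nodeSum_lt ρ β
  · intro i hi
    rw [eval_reducedSum ρ β hi]
    simp only [β, if_pos hi]
    rw [div_mul_cancel₀ _ (eval_reducedNode_self_ne_zero hi)]

theorem X_sub_C_sq_dvd_prod {ρ : Fin (N + 1) → ℝ} {i : Fin (N + 1)} (hi : i ∉ nodeReps ρ) :
    (X - C (ρ i)) ^ 2 ∣ ∏ j, (X - C (ρ j)) := by
  rw [prod_eq_common_mul_reduced, sq]
  refine mul_dvd_mul (Finset.dvd_prod_of_mem _ (Finset.mem_compl.2 hi)) ?_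
  have := Finset.dvd_prod_of_mem (fun j => X - C (ρ j)) (invFun_apply_mem_nodeReps ρ i)
  simp only [apply_invFun_apply] at this
  exact this

end Nodes

/-! ### Splitting of C and the equations for the initial data -/

section InitialData

variable {N : ℕ}

/-- The numbers `r_1, r_3, …, r_{2N+1}`. -/
def oddNode (r : Fin (2 * N + 1) → ℝ) (i : Fin (N + 1)) : ℝ := r ⟨2 * (i : ℕ), by omega⟩

theorem oddNode_monotone {r : Fin (2 * N + 1) → ℝ} (hr : Monotone r) : Monotone (oddNode r) := by
  intro i j h
  refine hr ?_
  rw [Fin.le_def] at h ⊢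
  simpa using h

theorem oddNode_succ (r : Fin (2 * N + 1) → ℝ) (i : Fin N) : oddNode r i.succ = gapRight r i :=
  rfl

theorem oddNode_castSucc_le {r : Fin (2 * N + 1) → ℝ} (hr : Monotone r) (i : Fin N) :
    oddNode r i.castSucc ≤ gapLeft r i :=
  hr (by rw [Fin.le_def]; simp)

theorem gapLeft_le_gapRight {r : Fin (2 * N + 1) → ℝ} (hr : Monotone r) (i : Fin N) :
    gapLeft r i ≤ gapRight r i :=
  hr (by rw [Fin.le_def]; simp)

theorem InGaps.interlaces {r : Fin (2 * N + 1) → ℝ} (hr : Monotone r) {q : Fin N → ℝ}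
    (h : InGaps r q) : Interlaces (oddNode r) q :=
  fun i => ⟨(oddNode_castSucc_le hr i).trans (h i).1, (h i).2⟩

theorem inGaps_gapLeft {r : Fin (2 * N + 1) → ℝ} (hr : Monotone r) : InGaps r (gapLeft r) :=
  fun i => ⟨le_rfl, gapLeft_le_gapRight hr i⟩

theorem prod_odd_mul_even {M : Type*} [CommMonoid M] : ∀ (N : ℕ) (f : Fin (2 * N + 1) → M),
    ∏ j, f j = (∏ i : Fin (N + 1), f ⟨2 * (i : ℕ), by omega⟩) *
      ∏ i : Fin N, f ⟨2 * (i : ℕ) + 1, by omega⟩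
  | 0, f => by simp
  | N + 1, f => by
    have h1 : ∏ j, f j = ((∏ j : Fin (2 * N + 1), f ⟨j, by omega⟩) * f ⟨2 * N + 1, by omega⟩) *
        f ⟨2 * N + 2, by omega⟩ :=
      (Fin.prod_univ_castSucc (n := 2 * N + 2) f).trans
        (congrArg (· * _) (Fin.prod_univ_castSucc (n := 2 * N + 1) _))
    rw [h1, prod_odd_mul_even N,
      Fin.prod_univ_castSucc (fun i : Fin (N + 1 + 1) => f ⟨2 * (i : ℕ), by omega⟩),
      Fin.prod_univ_castSucc (fun i : Fin (N + 1) => f ⟨2 * (i : ℕ) + 1, by omega⟩)]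
    have key : ∀ A B c d : M, A * B * c * d = A * d * (B * c) := fun A B c d => by ac_rfl
    exact key _ _ _ _

theorem basePoly_eq_prod_mul_prod {c : Fin (2 * N) → ℝ} {r : Fin (2 * N + 1) → ℝ}
    (hC : basePoly c = ∏ j, (X - C (r j))) :
    basePoly c = (∏ j, (X - C (oddNode r j))) * ∏ i, (X - C (gapLeft r i)) :=
  hC.trans (prod_odd_mul_even N _)

/-- The data sought satisfy α = y², p = y v and b = 2 m₀ v²; the relation α b = 2 m₀ p² makes these
compatible. -/
theorem exists_neumann_data_of_coeffs [NeZero N] {m₀ : ℝ} (hm₀ : 0 < m₀) {c : Fin (2 * N) → ℝ}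
    {ρ : Fin (N + 1) → ℝ} {w₀ u₀ a₀ : Fin N → ℝ} {α p b : Fin (N + 1) → ℝ}
    (hw : wPoly w₀ = nodeSum ρ α) (hu : lowPoly u₀ = C 2 * nodeSum ρ p)
    (ha : C m₀ * lowPoly a₀ =
      nodeSum ρ b + (C (2 * w₀ 0) - X) * nodeSum ρ α + ∏ j, (X - C (ρ j)))
    (hα : ∀ i, 0 ≤ α i) (hb : ∀ i, 0 ≤ b i) (hab : ∀ i, α i * b i = 2 * m₀ * p i ^ 2)
    (heq : basePoly c = C m₀ * (lowPoly a₀ * wPoly w₀ - C (1 / 2) * lowPoly u₀ ^ 2)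
      + (X - C (2 * w₀ 0)) * wPoly w₀ ^ 2) :
    ∃ z₀ : (Fin (N + 1) → ℝ) × (Fin (N + 1) → ℝ), ∑ i, z₀.1 i ^ 2 = 1 ∧
      ∑ i, z₀.1 i * z₀.2 i = 0 ∧ (wPoly w₀ = nodeSum ρ fun i => z₀.1 i ^ 2) ∧
      (lowPoly u₀ = C 2 * nodeSum ρ fun i => z₀.1 i * z₀.2 i) ∧
      neumannMultiplier m₀ ρ z₀ = 2 * w₀ 0 ∧ basePoly c = spectralPoly m₀ ρ z₀ := by
  classical
  let y : Fin (N + 1) → ℝ := fun i => √(α i)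
  -- Where α_i = 0 also p_i = 0, and only v_i² is prescribed, by b_i.
  let v : Fin (N + 1) → ℝ := fun i => if α i = 0 then √(b i / (2 * m₀)) else p i / √(α i)
  have hy : (fun i => y i ^ 2) = α := funext fun i => Real.sq_sqrt (hα i)
  have hyv : (fun i => y i * v i) = p := by
    funext i
    by_cases h : α i = 0
    · have hp : p i = 0 := by
        have := hab i
        rw [h, zero_mul, eq_comm, mul_eq_zero, or_iff_right (by positivity)] at this
        exact pow_eq_zero_iff two_ne_zero |>.1 this
      simp [y, h, hp]
    · have : √(α i) ≠ 0 := (Real.sqrt_ne_zero (hα i)).2 h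
      simp only [y, v, if_neg h]
      field_simp
  have hv : (fun i => 2 * m₀ * v i ^ 2) = b := by
    funext i
    by_cases h : α i = 0
    · simp only [v, if_pos h]
      rw [Real.sq_sqrt (div_nonneg (hb i) (by positivity))]
      field_simp
    · simp only [v, if_neg h]
      rw [div_pow, Real.sq_sqrt (hα i), ← mul_div_assoc, ← hab]
      field_simp
  -- Comparing coefficients of μ^N yields the sphere condition, the tangency and the value of the
  -- multiplier.
  have hs : ∑ i, α i = 1 := by
    rw [← coeff_nodeSum ρ, ← hw]
    have := (wPoly_monic w₀).coeff_natDegree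
    rwa [natDegree_wPoly] at this
  have hp0 : ∑ i, p i = 0 := by
    have h := congrArg (fun f => coeff f N) hu
    simp only [coeff_C_mul, coeff_nodeSum, coeff_lowPoly_of_le u₀ le_rfl] at h
    linarith
  have hmul : ∑ i, ρ i * α i - ∑ i, b i = 2 * w₀ 0 := by
    have h : C m₀ * lowPoly a₀ =
        nodeSum ρ b + C (2 * w₀ 0) * nodeSum ρ α - nodeSum ρ fun i => ρ i * α i := by
      rw [ha, sub_mul, X_mul_nodeSum, hs, C_1]
      ring
    have h := congrArg (fun f => coeff f N) h
    simp only [coeff_C_mul, coeff_sub, coeff_add, coeff_nodeSum, coeff_lowPoly_of_le a₀ le_rfl,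
      hs] at h
    linarith
  refine ⟨(y, v), ?_, ?_, ?_, ?_, ?_, ?_⟩
  · rw [← hs]
    exact Finset.sum_congr rfl fun i _ => congrFun hy i
  · rw [← hp0]
    exact Finset.sum_congr rfl fun i _ => congrFun hyv i
  · rw [hw, hy]
  · rw [hu, hyv]
  · rw [← hmul, neumannMultiplier, Finset.mul_sum]
    congr 1
    · exact Finset.sum_congr rfl fun i _ => congrArg (ρ i * ·) (congrFun hy i)
    · exact Finset.sum_congr rfl fun i _ => congrFun hv i
  · simp only [spectralPoly]
    rw [hy, hyv, ← nodeSum_smul, hv, heq, hu, hw]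
    have e : (C (1 / 2) : ℝ[X]) * C 2 ^ 2 = C 2 := by
      rw [← C_pow, ← C_mul]; norm_num
    have e2 : (C (2 * m₀) : ℝ[X]) = C 2 * C m₀ := C_mul
    linear_combination nodeSum ρ α * ha - C m₀ * nodeSum ρ p ^ 2 * e + nodeSum ρ p ^ 2 * e2

theorem reduced_factorization {m : ℝ} {ρ α p b e : Fin (N + 1) → ℝ}
    (hα : ∀ i ∉ nodeReps ρ, α i = 0) (hp : ∀ i ∉ nodeReps ρ, p i = 0)
    (hb : ∀ i ∉ nodeReps ρ, b i = 0) (he : ∀ i ∉ nodeReps ρ, e i = 0)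
    (h : nodeSum ρ α * (∏ j, (X - C (ρ j)) + nodeSum ρ b) - C m * nodeSum ρ p ^ 2
      = (∏ j, (X - C (ρ j))) * nodeSum ρ e) :
    reducedSum ρ α * (reducedProd ρ + reducedSum ρ b) - C m * reducedSum ρ p ^ 2
      = reducedProd ρ * reducedSum ρ e := by
  rw [nodeSum_eq_common_mul hα, nodeSum_eq_common_mul hb, nodeSum_eq_common_mul hp,
    nodeSum_eq_common_mul he, prod_eq_common_mul_reduced] at h
  refine mul_left_cancel₀ (pow_ne_zero 2 (commonPoly_monic ρ).ne_zero) ?_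
  linear_combination h

/-- Evaluation at `ρ i`, where the reduced product vanishes. -/
theorem mul_eq_of_reduced_factorization {m : ℝ} {ρ α p b e : Fin (N + 1) → ℝ}
    (h : reducedSum ρ α * (reducedProd ρ + reducedSum ρ b) - C m * reducedSum ρ p ^ 2
      = reducedProd ρ * reducedSum ρ e) {i : Fin (N + 1)} (hi : i ∈ nodeReps ρ) :
    α i * b i = m * p i ^ 2 := by
  have := congrArg (eval (ρ i)) h
  simp only [eval_sub, eval_mul, eval_add, eval_pow, eval_C, eval_reducedSum _ _ hi,
    eval_reducedProd hi] at this
  have hd := eval_reducedNode_self_ne_zero hi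
  refine mul_left_cancel₀ (pow_ne_zero 2 hd) ?_
  linear_combination this

/-- If `α i = p i = 0`, evaluation says nothing about `b i`; the first derivative at `ρ i` does. -/
theorem derivative_reducedSum_mul {m : ℝ} {ρ α p b e : Fin (N + 1) → ℝ}
    (h : reducedSum ρ α * (reducedProd ρ + reducedSum ρ b) - C m * reducedSum ρ p ^ 2
      = reducedProd ρ * reducedSum ρ e) {i : Fin (N + 1)} (hi : i ∈ nodeReps ρ)
    (hα : α i = 0) (hp : p i = 0) :
    (derivative (reducedSum ρ α)).eval (ρ i) * b i = (reducedSum ρ e).eval (ρ i) := by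
  have hd := eval_reducedNode_self_ne_zero hi
  have hD : (derivative (reducedProd ρ)).eval (ρ i) = (reducedNode ρ i).eval (ρ i) := by
    rw [reducedProd_eq hi]
    simp
  have h' := congrArg (fun f => (derivative f).eval (ρ i)) h
  simp only [derivative_sub, derivative_mul, derivative_add, derivative_C, derivative_pow, eval_sub,
    eval_mul, eval_add, eval_pow, eval_C, eval_reducedSum _ α hi, eval_reducedSum _ p hi,
    eval_reducedSum _ b hi, eval_reducedProd hi, hα, hp, hD] at h'
  refine mul_left_cancel₀ hd ?_
  simp only [eval_zero, zero_mul, zero_add, add_zero] at h'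
  linear_combination h'

end InitialData

/-! ### Existence of Neumann initial data -/

section InitialPoint

variable {N : ℕ}

/-- Only b ≥ 0 needs an argument. Where α_i > 0 it follows from α_i b_i = 2 m₀ p_i²; where α_i = 0
one has b_i = m₀ γ_i, and the sign is left to `hγ`. -/
theorem exists_neumann_data [NeZero N] {m₀ : ℝ} (hm₀ : 0 < m₀) {c : Fin (2 * N) → ℝ}
    {ρ : Fin (N + 1) → ℝ} {w₀ u₀ a₀ : Fin N → ℝ} {α p γ e : Fin (N + 1) → ℝ}
    (hαs : ∀ i ∉ nodeReps ρ, α i = 0) (hps : ∀ i ∉ nodeReps ρ, p i = 0)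
    (hγs : ∀ i ∉ nodeReps ρ, γ i = 0) (hes : ∀ i ∉ nodeReps ρ, e i = 0)
    (hw : wPoly w₀ = nodeSum ρ α) (hu : lowPoly u₀ = C 2 * nodeSum ρ p)
    (ha : lowPoly a₀ = nodeSum ρ γ) (hα : ∀ i, 0 ≤ α i)
    (hC : basePoly c = (∏ j, (X - C (ρ j))) * nodeSum ρ e)
    (heq : basePoly c = C m₀ * (lowPoly a₀ * wPoly w₀ - C (1 / 2) * lowPoly u₀ ^ 2)
      + (X - C (2 * w₀ 0)) * wPoly w₀ ^ 2)
    (hγ : ∀ i ∈ nodeReps ρ, α i = 0 →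
      (derivative (reducedSum ρ α)).eval (ρ i) * (m₀ * γ i) = (reducedSum ρ e).eval (ρ i) →
      0 ≤ γ i) :
    ∃ z₀ : (Fin (N + 1) → ℝ) × (Fin (N + 1) → ℝ), ∑ i, z₀.1 i ^ 2 = 1 ∧
      ∑ i, z₀.1 i * z₀.2 i = 0 ∧ (wPoly w₀ = nodeSum ρ fun i => z₀.1 i ^ 2) ∧
      (lowPoly u₀ = C 2 * nodeSum ρ fun i => z₀.1 i * z₀.2 i) ∧
      neumannMultiplier m₀ ρ z₀ = 2 * w₀ 0 ∧ basePoly c = spectralPoly m₀ ρ z₀ := by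
  let b : Fin (N + 1) → ℝ := fun i => m₀ * γ i + (ρ i * α i + -(2 * w₀ 0) * α i)
  have hbs : ∀ i ∉ nodeReps ρ, b i = 0 := fun i hi => by simp [b, hαs i hi, hγs i hi]
  have hs : ∑ i, α i = 1 := by
    rw [← coeff_nodeSum ρ, ← hw]
    have := (wPoly_monic w₀).coeff_natDegree
    rwa [natDegree_wPoly] at this
  have hbsum : C m₀ * lowPoly a₀ =
      nodeSum ρ b + (C (2 * w₀ 0) - X) * nodeSum ρ α + ∏ j, (X - C (ρ j)) := by
    have h1 : nodeSum ρ b = C m₀ * nodeSum ρ γ +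
        ((nodeSum ρ fun i => ρ i * α i) + C (-(2 * w₀ 0)) * nodeSum ρ α) := by
      rw [← nodeSum_smul, ← nodeSum_smul, ← nodeSum_add, ← nodeSum_add]
    rw [h1, ha, sub_mul, X_mul_nodeSum, hs, C_1, C_neg]
    ring
  have hfac : nodeSum ρ α * (∏ j, (X - C (ρ j)) + nodeSum ρ b) - C (2 * m₀) * nodeSum ρ p ^ 2
      = (∏ j, (X - C (ρ j))) * nodeSum ρ e := by
    rw [← hC, heq, hu, hw]
    have e1 : (C (1 / 2) : ℝ[X]) * C 2 ^ 2 = C 2 := by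
      rw [← C_pow, ← C_mul]; norm_num
    have e2 : (C (2 * m₀) : ℝ[X]) = C 2 * C m₀ := C_mul
    linear_combination (-nodeSum ρ α) * hbsum + C m₀ * nodeSum ρ p ^ 2 * e1 - nodeSum ρ p ^ 2 * e2
  have hred := reduced_factorization hαs hps hbs hes hfac
  have hab : ∀ i, α i * b i = 2 * m₀ * p i ^ 2 := by
    intro i
    by_cases hi : i ∈ nodeReps ρ
    · exact mul_eq_of_reduced_factorization hred hi
    · rw [hαs i hi, hps i hi]
      ring
  refine exists_neumann_data_of_coeffs hm₀ hw hu hbsum hα (fun i => ?_) hab heq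
  by_cases hi : i ∈ nodeReps ρ
  · rcases (hα i).eq_or_lt with h0 | h0
    · have hp0 : p i = 0 := by
        have := hab i
        rw [← h0, zero_mul, eq_comm, mul_eq_zero, or_iff_right (by positivity)] at this
        exact pow_eq_zero_iff two_ne_zero |>.1 this
      have hb : b i = m₀ * γ i := by simp [b, ← h0]
      rw [hb]
      refine mul_nonneg hm₀.le (hγ i hi h0.symm ?_)
      rw [← hb]
      exact derivative_reducedSum_mul hred hi h0.symm hp0
    · have h1 : 0 ≤ α i * b i := by
        rw [hab]
        positivity
      exact nonneg_of_mul_nonneg_right h1 h0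
  · rw [hbs i hi]

/-- A negative second derivative would make the minimum a maximum as well, so `f` would be locally
constant. -/
theorem IsLocalMin.second_deriv_nonneg {f f' : ℝ → ℝ} {f'' x : ℝ} (hmin : IsLocalMin f x)
    (hf : ∀ᶠ y in 𝓝 x, HasDerivAt f (f' y) y) (hf' : HasDerivAt f' f'' x) : 0 ≤ f'' := by
  by_contra! hneg
  have hd : deriv f =ᶠ[𝓝 x] f' := hf.mono fun y hy => hy.deriv
  have hdd : deriv (deriv f) x = f'' := by rw [hd.deriv_eq, hf'.deriv]
  have hmax : IsLocalMax f x := isLocalMax_of_deriv_deriv_neg (by rwa [hdd]) hmin.deriv_eq_zero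
    hf.self_of_nhds.continuousAt
  have hc : f =ᶠ[𝓝 x] fun _ => f x := by
    filter_upwards [hmin, hmax] with y h1 h2 using le_antisymm h2 h1
  have h0 : deriv (deriv f) x = 0 := by
    rw [hc.deriv.deriv_eq]
    simp
  linarith

/-- The weights of w(x; ·) are nonnegative near 0, so a weight vanishing at 0 has a minimum there
and its second derivative is nonnegative. -/
theorem exists_neumann_data_of_eventually [NeZero N] {m₀ : ℝ} (hm₀ : 0 < m₀)
    {c : Fin (2 * N) → ℝ} {r : Fin (2 * N + 1) → ℝ} (hr : Monotone r)
    (hC : basePoly c = ∏ j, (X - C (r j))) {J : Set ℝ} (hJ : IsOpen J) (h0 : (0 : ℝ) ∈ J)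
    {w : ℝ → Fin N → ℝ} (hw : IsBaseSolutionOn m₀ c J w)
    (hgap : ∀ᶠ x in 𝓝 (0 : ℝ), ∃ p : Fin N → ℝ, IsRootList (w x) p ∧ InGaps r p) :
    ∃ z₀ : (Fin (N + 1) → ℝ) × (Fin (N + 1) → ℝ), ∑ i, z₀.1 i ^ 2 = 1 ∧
      ∑ i, z₀.1 i * z₀.2 i = 0 ∧ (wPoly (w 0) = nodeSum (oddNode r) fun i => z₀.1 i ^ 2) ∧
      (lowPoly (deriv w 0) = C 2 * nodeSum (oddNode r) fun i => z₀.1 i * z₀.2 i) ∧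
      neumannMultiplier m₀ (oddNode r) z₀ = 2 * w 0 0 ∧
      basePoly c = spectralPoly m₀ (oddNode r) z₀ := by
  set ρ := oddNode r
  have hρ : Monotone ρ := oddNode_monotone hr
  obtain ⟨l, hl1, hl2⟩ := exists_nodeCoeff ρ
  obtain ⟨e', he'0, -, he'⟩ := ((inGaps_gapLeft hr).interlaces hr).exists_nodeSum hρ
  obtain ⟨e, -, hes, he⟩ := exists_nodeSum_reps ρ he'0
  have hrep : ∀ᶠ x in 𝓝 (0 : ℝ), wPoly (w x) = nodeSum ρ (l (wPoly (w x))) ∧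
      ∀ i, 0 ≤ l (wPoly (w x)) i := by
    filter_upwards [hgap] with x hx
    obtain ⟨p, hp, hpg⟩ := hx
    obtain ⟨α', hα'0, -, hα'⟩ := (hpg.interlaces hr).exists_nodeSum hρ
    obtain ⟨α, hα0, hαs, hα⟩ := exists_nodeSum_reps ρ hα'0
    have h : wPoly (w x) = nodeSum ρ α := by rw [hp.2, hα', hα]
    rw [h, hl2 α hαs]
    exact ⟨rfl, hα0⟩
  have hd1 : ∀ᶠ x in 𝓝 (0 : ℝ), HasDerivAt w (deriv w x) x := by
    filter_upwards [hJ.mem_nhds h0] with x hx using (hw x hx).1.hasDerivAt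
  have hd2 : HasDerivAt (deriv w) (deriv (deriv w) 0) 0 := (hw 0 h0).2.1.hasDerivAt
  -- `Λ t` vanishes on combinations of node polynomials supported on the representatives. Being
  -- linear and zero along w near 0, it also vanishes on w_x and w_xx at 0, which are therefore such
  -- combinations.
  let Λ : ℝ → ℝ[X] →ₗ[ℝ] ℝ := fun t => leval t - ∑ i, (nodePoly ρ i).eval t •
    (LinearMap.proj i ∘ₗ l)
  have hΛ : ∀ t p, Λ t p = 0 ↔ p.eval t = (nodeSum ρ (l p)).eval t := by
    intro t p
    have : (nodeSum ρ (l p)).eval t = ∑ i, (nodePoly ρ i).eval t * l p i := by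
      rw [eval_nodeSum]
      exact Finset.sum_congr rfl fun i _ => mul_comm _ _
    rw [this]
    simp [Λ, leval_apply, sub_eq_zero]
  have hΛ1 : ∀ t, ∀ᶠ x in 𝓝 (0 : ℝ), Λ t (lowPoly (deriv w x)) = 0 := by
    intro t
    have h : (fun x => Λ t (wPoly (w x))) =ᶠ[𝓝 0] fun _ => 0 := by
      filter_upwards [hrep] with x hx
      rw [hΛ, ← hx.1]
    filter_upwards [h.eventuallyEq_nhds, hd1] with x hx hx1
    rw [← (hx1.map_wPoly (Λ t)).deriv, hx.deriv_eq, deriv_const]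
  have hΛ2 : ∀ t, Λ t (lowPoly (deriv (deriv w) 0)) = 0 := by
    intro t
    have h : (fun x => Λ t (lowPoly (deriv w x))) =ᶠ[𝓝 0] fun _ => 0 := hΛ1 t
    rw [← (hd2.map_lowPoly (Λ t)).deriv, h.deriv_eq, deriv_const]
  have hu : lowPoly (deriv w 0) = nodeSum ρ (l (lowPoly (deriv w 0))) :=
    Polynomial.funext fun t => (hΛ t _).1 (hΛ1 t).self_of_nhds
  have ha : lowPoly (deriv (deriv w) 0) = nodeSum ρ (l (lowPoly (deriv (deriv w) 0))) :=
    Polynomial.funext fun t => (hΛ t _).1 (hΛ2 t)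
  refine exists_neumann_data hm₀ (p := fun i => 1 / 2 * l (lowPoly (deriv w 0)) i) (e := e)
    (hl1 _) (fun i hi => by rw [hl1 _ i hi, mul_zero]) (hl1 _) hes hrep.self_of_nhds.1 ?_ ha
    hrep.self_of_nhds.2 ?_ (hw 0 h0).2.2 ?_
  · rw [nodeSum_smul, ← hu, ← mul_assoc, ← C_mul]
    norm_num
  · rw [basePoly_eq_prod_mul_prod hC, he', he]
  · intro i _ hi _
    have hmin : IsLocalMin (fun x => l (wPoly (w x)) i) 0 := by
      filter_upwards [hrep] with x hx
      rw [hi]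
      exact hx.2 i
    exact hmin.second_deriv_nonneg
      (hd1.mono fun x hx => hx.map_wPoly (LinearMap.proj i ∘ₗ l))
      (hd2.map_lowPoly (LinearMap.proj i ∘ₗ l))

/-- At a simple zero of `W`, evaluating the identity kills `U`; after cancelling one factor X − t,
evaluating again kills `A`. -/
theorem eval_eq_zero_of_double_root {m₀ : ℝ} (hm₀ : m₀ ≠ 0) {B W U A G : ℝ[X]} {t : ℝ}
    (h : B = C m₀ * (A * W - C (1 / 2) * U ^ 2) + G * W ^ 2) (hB : (X - C t) ^ 2 ∣ B)
    (hW : W.eval t = 0) (hW' : ¬ (X - C t) ^ 2 ∣ W) : U.eval t = 0 ∧ A.eval t = 0 := by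
  obtain ⟨B', rfl⟩ := hB
  obtain ⟨V, rfl⟩ := dvd_iff_isRoot.2 hW
  have hV : V.eval t ≠ 0 := by
    intro hV
    obtain ⟨V', rfl⟩ := dvd_iff_isRoot.2 hV
    exact hW' ⟨V', by ring⟩
  have hU : U.eval t = 0 := by
    have := congrArg (eval t) h
    simp only [eval_mul, eval_add, eval_sub, eval_pow, eval_X, eval_C] at this
    have h2 : m₀ * (U.eval t) ^ 2 = 0 := by linear_combination 2 * this
    exact pow_eq_zero_iff two_ne_zero |>.1 ((mul_eq_zero.1 h2).resolve_left hm₀)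
  refine ⟨hU, ?_⟩
  obtain ⟨U', rfl⟩ := dvd_iff_isRoot.2 hU
  have h' : (X - C t) * B' = C m₀ * (A * V - C (1 / 2) * (X - C t) * U' ^ 2)
      + G * (X - C t) * V ^ 2 := by
    refine mul_left_cancel₀ (X_sub_C_ne_zero t) ?_
    linear_combination h
  have := congrArg (eval t) h'
  simp only [eval_mul, eval_add, eval_sub, eval_pow, eval_X, eval_C] at this
  have h2 : m₀ * (A.eval t * V.eval t) = 0 := by linear_combination -this
  exact (mul_eq_zero.1 ((mul_eq_zero.1 h2).resolve_left hm₀)).resolve_right hV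

theorem not_sq_dvd_of_injective {q : Fin N → ℝ} (hq : Function.Injective q) (t : ℝ) :
    ¬ (X - C t) ^ 2 ∣ ∏ i, (X - C (q i)) := by
  intro h
  have hs : Squarefree (∏ i, (X - C (q i))) := (separable_prod_X_sub_C_iff.2 hq).squarefree
  exact not_isUnit_X_sub_C t (hs _ (by rwa [← sq]))

/-- If the node is the root q_s, the unpaired factor is q_s − r_{2s} ≥ 0. For each other j, q_j and
r_{2j} lie on the same side of the node. -/
theorem eval_gapLeft_mul_derivative_nonneg {r : Fin (2 * N + 1) → ℝ} (hr : Monotone r)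
    {q : Fin N → ℝ} (hq : InGaps r q) (i : Fin (N + 1))
    (h0 : (∏ s, (X - C (q s))).eval (oddNode r i) = 0) :
    0 ≤ (∏ s, (X - C (gapLeft r s))).eval (oddNode r i) *
      (derivative (∏ s, (X - C (q s)))).eval (oddNode r i) := by
  classical
  set t := oddNode r i with ht
  obtain ⟨s, -, hs⟩ := Finset.prod_eq_zero_iff.1 (by simpa [eval_prod] using h0)
  have hs : t = q s := sub_eq_zero.1 hs
  have hd : (derivative (∏ s, (X - C (q s)))).eval t = ∏ j ∈ Finset.univ.erase s, (t - q j) := by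
    rw [← Finset.mul_prod_erase _ _ (Finset.mem_univ s)]
    simp [← hs, eval_prod]
  rw [hd, eval_prod, ← Finset.mul_prod_erase _ _ (Finset.mem_univ s), mul_assoc,
    ← Finset.prod_mul_distrib]
  refine mul_nonneg ?_ (Finset.prod_nonneg fun j _ => ?_)
  · simp only [eval_sub, eval_X, eval_C, hs, sub_nonneg]
    exact (hq s).1
  · simp only [eval_sub, eval_X, eval_C]
    have hmono := oddNode_monotone hr
    rcases lt_or_ge j.castSucc i with h | h
    · have h1 : gapRight r j ≤ t := by
        rw [← oddNode_succ]
        exact hmono (by rw [Fin.lt_def] at h; rw [Fin.le_def]; simpa using h)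
      exact mul_nonneg (by linarith [(hq j).1, (hq j).2]) (by linarith [(hq j).2])
    · have h1 : t ≤ gapLeft r j := (hmono h).trans (oddNode_castSucc_le hr j)
      exact mul_nonneg_of_nonpos_of_nonpos (by linarith) (by linarith [(hq j).1])

/-- Roots of the common factor are simple roots of w and double roots of C, so w_x and w_xx vanish
there and are combinations of node polynomials. This needs no information away from x = 0. -/
theorem exists_neumann_data_of_injective [NeZero N] {m₀ : ℝ} (hm₀ : 0 < m₀)
    {c : Fin (2 * N) → ℝ} {r : Fin (2 * N + 1) → ℝ} (hr : Monotone r)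
    (hC : basePoly c = ∏ j, (X - C (r j))) {w₀ u₀ a₀ q : Fin N → ℝ}
    (heq : basePoly c = C m₀ * (lowPoly a₀ * wPoly w₀ - C (1 / 2) * lowPoly u₀ ^ 2)
      + (X - C (2 * w₀ 0)) * wPoly w₀ ^ 2)
    (hq : IsRootList w₀ q) (hgap : InGaps r q) (hinj : Function.Injective q) :
    ∃ z₀ : (Fin (N + 1) → ℝ) × (Fin (N + 1) → ℝ), ∑ i, z₀.1 i ^ 2 = 1 ∧
      ∑ i, z₀.1 i * z₀.2 i = 0 ∧ (wPoly w₀ = nodeSum (oddNode r) fun i => z₀.1 i ^ 2) ∧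
      (lowPoly u₀ = C 2 * nodeSum (oddNode r) fun i => z₀.1 i * z₀.2 i) ∧
      neumannMultiplier m₀ (oddNode r) z₀ = 2 * w₀ 0 ∧
      basePoly c = spectralPoly m₀ (oddNode r) z₀ := by
  have hev := eval_gapLeft_mul_derivative_nonneg hr hgap
  have hCE := basePoly_eq_prod_mul_prod hC
  set ρ := oddNode r
  have hρ : Monotone ρ := oddNode_monotone hr
  obtain ⟨e', he'0, -, he'⟩ := ((inGaps_gapLeft hr).interlaces hr).exists_nodeSum hρ
  obtain ⟨e, -, hes, he⟩ := exists_nodeSum_reps ρ he'0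
  obtain ⟨α', hα'0, -, hα'⟩ := (hgap.interlaces hr).exists_nodeSum hρ
  obtain ⟨α, hα0, hαs, hα⟩ := exists_nodeSum_reps ρ hα'0
  have hw : wPoly w₀ = nodeSum ρ α := by rw [hq.2, hα', hα]
  have hsq : ∀ t, ¬ (X - C t) ^ 2 ∣ wPoly w₀ := by
    rw [hq.2]
    exact not_sq_dvd_of_injective hinj
  have hPw : commonPoly ρ ∣ wPoly w₀ := ⟨_, hw.trans (nodeSum_eq_common_mul hαs)⟩
  have hroot : ∀ i ∉ nodeReps ρ, (lowPoly u₀).eval (ρ i) = 0 ∧ (lowPoly a₀).eval (ρ i) = 0 := by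
    intro i hi
    refine eval_eq_zero_of_double_root hm₀.ne' heq ?_ ?_ (hsq _)
    · rw [hCE]
      exact (X_sub_C_sq_dvd_prod hi).mul_right _
    · exact dvd_iff_isRoot.1 ((Finset.dvd_prod_of_mem (fun j => X - C (ρ j))
        (Finset.mem_compl.2 hi)).trans hPw)
  have hdvd : ∀ f : ℝ[X], (∀ i ∉ nodeReps ρ, f.eval (ρ i) = 0) → commonPoly ρ ∣ f := by
    intro f hf
    refine Finset.prod_dvd_of_coprime (fun i hi j hj hij => ?_) fun i hi =>
      dvd_iff_isRoot.2 (hf i (Finset.mem_compl.1 hi))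
    -- The common factor divides the squarefree w, so its linear factors are distinct.
    refine isCoprime_X_sub_C_of_isUnit_sub (IsUnit.mk0 _ (sub_ne_zero.2 fun hρij => ?_))
    refine hsq (ρ i) (Dvd.dvd.trans ?_ hPw)
    rw [commonPoly, ← Finset.mul_prod_erase _ _ hi, sq]
    refine mul_dvd_mul_left _ ?_
    rw [hρij]
    exact Finset.dvd_prod_of_mem (fun j => X - C (ρ j)) (Finset.mem_erase.2 ⟨hij.symm, hj⟩)
  have hdeg : ∀ v : Fin N → ℝ, (lowPoly v).degree < (N + 1 : ℕ) := fun v =>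
    (degree_lowPoly_lt v).trans (by exact_mod_cast N.lt_succ_self)
  obtain ⟨p, hps, hp⟩ := exists_nodeSum_of_common_dvd (hdeg u₀) (hdvd _ fun i hi => (hroot i hi).1)
  obtain ⟨γ, hγs, hγ⟩ := exists_nodeSum_of_common_dvd (hdeg a₀) (hdvd _ fun i hi => (hroot i hi).2)
  refine exists_neumann_data hm₀ (p := fun i => 1 / 2 * p i) (e := e)
    hαs (fun i hi => by rw [hps i hi, mul_zero]) hγs hes hw ?_ hγ hα0 ?_ heq ?_
  · rw [nodeSum_smul, ← hp, ← mul_assoc, ← C_mul]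
    norm_num
  · rw [hCE, he', he]
  · intro i hi h0 h
    have hA : (reducedSum ρ α).eval (ρ i) = 0 := by rw [eval_reducedSum ρ α hi, h0, zero_mul]
    have hwi : (wPoly w₀).eval (ρ i) = 0 := by
      rw [hw, nodeSum_eq_common_mul hαs, eval_mul, hA, mul_zero]
    have hdw : (derivative (wPoly w₀)).eval (ρ i) =
        (commonPoly ρ).eval (ρ i) * (derivative (reducedSum ρ α)).eval (ρ i) := by
      rw [hw, nodeSum_eq_common_mul hαs, derivative_mul, eval_add, eval_mul, eval_mul, hA, mul_zero,
        zero_add]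
    have hdw0 : (derivative (wPoly w₀)).eval (ρ i) ≠ 0 := by
      have hsep : (wPoly w₀).Separable := by
        rw [hq.2]
        exact separable_prod_X_sub_C_iff.2 hinj
      intro hd
      obtain ⟨a, b, hab⟩ := hsep
      have := congrArg (eval (ρ i)) hab
      simp [hwi, hd] at this
    have hE : (∏ s, (X - C (gapLeft r s))).eval (ρ i)
        = (derivative (wPoly w₀)).eval (ρ i) * (m₀ * γ i) := by
      rw [he', he, nodeSum_eq_common_mul hes, eval_mul, ← h, hdw]
      ring
    have h1 := hev i (by rw [← hq.2]; exact hwi)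
    rw [← hq.2, hE] at h1
    -- Substituting `hE` into the sign condition gives 0 ≤ m₀ w'(ρ_i)² γ_i, and w'(ρ_i) ≠ 0 because
    -- w is separable.
    have h2 : 0 < m₀ * (derivative (wPoly w₀)).eval (ρ i) ^ 2 := by positivity
    refine nonneg_of_mul_nonneg_right (a := m₀ * (derivative (wPoly w₀)).eval (ρ i) ^ 2) ?_ h2
    linarith

end InitialPoint

/-! ### Uniqueness, the gap condition and smooth roots -/

section GlobalBehaviour

variable {N : ℕ}

theorem IsBaseSolutionOn.eqOn [NeZero N] {m₀ : ℝ} (hm₀ : m₀ ≠ 0) {c : Fin (2 * N) → ℝ}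
    {J : Set ℝ} (hJ : J.OrdConnected) {w W : ℝ → Fin N → ℝ} (hw : IsBaseSolutionOn m₀ c J w)
    (hW : IsBaseSolutionOn m₀ c J W) {x₀ : ℝ} (hx₀ : x₀ ∈ J) (h : W x₀ = w x₀)
    (h' : deriv W x₀ = deriv w x₀) : EqOn W w J := by
  obtain ⟨Φ, hΦ, hΦ'⟩ := exists_contDiff_acceleration hm₀ (basePoly c) (N := N)
  have hF : ContDiff ℝ 1 fun z : (Fin N → ℝ) × (Fin N → ℝ) => (z.2, Φ z) :=
    contDiff_snd.prodMk (hΦ.of_le (by exact_mod_cast le_top))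
  have key : ∀ u : ℝ → Fin N → ℝ, IsBaseSolutionOn m₀ c J u → ∀ t ∈ J,
      HasDerivAt (fun x => (u x, deriv u x)) (deriv u t, Φ (u t, deriv u t)) t := by
    intro u hu t ht
    rw [← hΦ' _ _ _ (hu t ht).2.2]
    exact (hu t ht).1.hasDerivAt.prodMk (hu t ht).2.1.hasDerivAt
  have := eqOn_of_hasDerivAt_field hF hJ hx₀ (key W hW) (key w hw) (by rw [h, h'])
  exact fun t ht => congrArg Prod.fst (this ht)

/-- One factor is left over and is positive; the others pair up, each pair having both members on
the same side of `t`. -/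
theorem eval_basePoly_pos {c : Fin (2 * N) → ℝ} {r : Fin (2 * N + 1) → ℝ} (hr : Monotone r)
    (hC : basePoly c = ∏ j, (X - C (r j))) {i : Fin N} {t : ℝ} (h1 : oddNode r i.castSucc < t)
    (h2 : t < gapLeft r i) : 0 < (basePoly c).eval t := by
  rw [basePoly_eq_prod_mul_prod hC, Fin.prod_univ_succAbove _ i.castSucc, mul_assoc,
    ← Finset.prod_mul_distrib, eval_mul, eval_prod]
  simp only [eval_mul, eval_sub, eval_X, eval_C]
  have hmono := oddNode_monotone hr
  refine mul_pos (by linarith) (Finset.prod_pos fun s _ => ?_)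
  rcases lt_or_ge s.castSucc i.castSucc with h | h
  · rw [Fin.succAbove_of_castSucc_lt _ _ h]
    have e1 := hmono h.le
    have e2 : gapRight r s ≤ oddNode r i.castSucc := by
      rw [← oddNode_succ]
      exact hmono (by rw [Fin.lt_def] at h; rw [Fin.le_def]; simpa using h)
    have e3 := gapLeft_le_gapRight hr s
    exact mul_pos (by linarith) (by linarith)
  · rw [Fin.succAbove_of_le_castSucc _ _ h, oddNode_succ]
    have e1 : gapLeft r i ≤ gapLeft r s := by
      rw [Fin.le_def] at h
      exact hr (by rw [Fin.le_def]; simpa using h)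
    have e3 := gapLeft_le_gapRight hr s
    exact mul_pos_of_neg_of_neg (by linarith) (by linarith)

/-- At a root of w the base system reads C = −½ m₀ w_x² ≤ 0. -/
theorem IsBaseSolutionOn.eval_ne_zero [NeZero N] {m₀ : ℝ} (hm₀ : 0 < m₀) {c : Fin (2 * N) → ℝ}
    {J : Set ℝ} {w : ℝ → Fin N → ℝ} (hw : IsBaseSolutionOn m₀ c J w) {x : ℝ} (hx : x ∈ J) {t : ℝ}
    (ht : 0 < (basePoly c).eval t) : (wPoly (w x)).eval t ≠ 0 := by
  intro h
  rw [(hw x hx).2.2] at ht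
  simp only [eval_mul, eval_add, eval_sub, eval_pow, eval_X, eval_C, h] at ht
  have : 0 ≤ m₀ * ((lowPoly (deriv w x)).eval t) ^ 2 := by positivity
  linarith

/-- The gap condition propagates along global solutions with interlacing zeros. -/
theorem inGaps_of_inGaps_zero [NeZero N] {m₀ : ℝ} (hm₀ : 0 < m₀) {c : Fin (2 * N) → ℝ}
    {r : Fin (2 * N + 1) → ℝ} (hr : Monotone r) (hC : basePoly c = ∏ j, (X - C (r j)))
    {W : ℝ → Fin N → ℝ} (hW : IsBaseSolutionOn m₀ c univ W) {q₀ : Fin N → ℝ}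
    (hq₀ : IsRootList (W 0) q₀) (hgap : InGaps r q₀) {x : ℝ} {q : Fin N → ℝ}
    (hq : wPoly (W x) = ∏ i, (X - C (q i))) (hI : Interlaces (oddNode r) q) : InGaps r q := by
  intro i
  refine ⟨?_, (hI i).2⟩
  by_contra! hlt
  -- At this `t` one has C(t) > 0, so w(·; t) never vanishes. But w(0; t) and w(x; t) have opposite
  -- signs: the i-th root has crossed `t` and no other root has.
  set t := (q i + gapLeft r i) / 2 with ht
  have ht1 : q i < t := by linarith
  have ht2 : t < gapLeft r i := by linarith
  have hpos := eval_basePoly_pos hr hC ((hI i).1.trans_lt ht1) ht2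
  have hmono := oddNode_monotone hr
  have hneg : (wPoly (W 0)).eval t * (wPoly (W x)).eval t < 0 := by
    rw [hq, hq₀.2, eval_prod, eval_prod, ← Finset.prod_mul_distrib,
      ← Finset.mul_prod_erase _ _ (Finset.mem_univ i)]
    simp only [eval_sub, eval_X, eval_C]
    refine mul_neg_of_neg_of_pos (mul_neg_of_neg_of_pos (by linarith [(hgap i).1]) (by linarith))
      (Finset.prod_pos fun s hs => ?_)
    have hI₀ := hgap.interlaces hr
    rcases lt_or_gt_of_ne (Finset.ne_of_mem_erase hs) with h | h
    · have e := hmono (Fin.succ_le_castSucc_iff.2 h)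
      exact mul_pos (by linarith [(hI₀ s).2, (hI i).1]) (by linarith [(hI s).2, (hI i).1])
    · have e := hmono (Fin.succ_le_castSucc_iff.2 h)
      rw [oddNode_succ] at e
      have e2 := gapLeft_le_gapRight hr i
      exact mul_pos_of_neg_of_neg (by linarith [(hI₀ s).1]) (by linarith [(hI s).1])
  have hcont : Continuous fun y => (wPoly (W y)).eval t := continuous_iff_continuousAt.2 fun y =>
    ((hW y (mem_univ y)).1.hasDerivAt.map_wPoly (leval t)).continuousAt
  have hne : ∀ y, (wPoly (W y)).eval t ≠ 0 := fun y => hW.eval_ne_zero hm₀ (mem_univ y) hpos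
  rcases mul_neg_iff.1 hneg with h | h
  · obtain ⟨y, hy⟩ := mem_range_of_exists_le_of_exists_ge hcont ⟨x, h.2.le⟩ ⟨0, h.1.le⟩
    exact hne y hy
  · obtain ⟨y, hy⟩ := mem_range_of_exists_le_of_exists_ge hcont ⟨0, h.1.le⟩ ⟨x, h.2.le⟩
    exact hne y hy

theorem InGaps.notMem_Ioo {r : Fin (2 * N + 1) → ℝ} (hr : Monotone r) {q : Fin N → ℝ}
    (h : InGaps r q) {i s : Fin N} (hs : s ≠ i) : q s ≤ gapLeft r i ∨ gapRight r i ≤ q s := by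
  rcases lt_or_gt_of_ne hs with h' | h'
  · refine .inl ((h s).2.trans (hr ?_))
    rw [Fin.lt_def] at h'
    rw [Fin.le_def]
    simp only
    omega
  · refine .inr (le_trans (hr ?_) (h s).1)
    rw [Fin.lt_def] at h'
    rw [Fin.le_def]
    simp only
    omega

theorem eval_basePoly_ne_zero {c : Fin (2 * N) → ℝ} {r : Fin (2 * N + 1) → ℝ} (hr : Monotone r)
    (hC : basePoly c = ∏ j, (X - C (r j))) {i : Fin N} {t : ℝ} (h1 : gapLeft r i < t)
    (h2 : t < gapRight r i) : (basePoly c).eval t ≠ 0 := by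
  rw [hC, eval_prod, Finset.prod_ne_zero_iff]
  intro j _
  rw [eval_sub, eval_X, eval_C, sub_ne_zero]
  rintro rfl
  by_cases hj : (j : ℕ) ≤ 2 * (i : ℕ) + 1
  · exact absurd h1 (not_lt.2 (hr (by rw [Fin.le_def]; exact hj)))
  · exact absurd h2 (not_lt.2 (hr (by rw [Fin.le_def]; simp only; omega)))

theorem eval_derivative_prod {q : Fin N → ℝ} (i : Fin N) :
    (derivative (∏ s, (X - C (q s)))).eval (q i) = ∏ s ∈ Finset.univ.erase i, (q i - q s) := by
  rw [← Finset.mul_prod_erase _ _ (Finset.mem_univ i)]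
  simp [eval_prod]

theorem eval_wPoly (v : Fin N → ℝ) (t : ℝ) :
    (wPoly v).eval t = t ^ N + ∑ k : Fin N, v k * t ^ (N - 1 - (k : ℕ)) := by
  simp [wPoly, lowPoly, eval_finsetSum]

theorem HasDerivAt.eval_wPoly {w : ℝ → Fin N → ℝ} {w' : Fin N → ℝ} {g : ℝ → ℝ} {g' x : ℝ}
    (hw : HasDerivAt w w' x) (hg : HasDerivAt g g' x) :
    HasDerivAt (fun y => (wPoly (w y)).eval (g y))
      ((lowPoly w').eval (g x) + g' * (derivative (wPoly (w x))).eval (g x)) x := by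
  simp only [_root_.eval_wPoly]
  refine ((hg.pow N).add (HasDerivAt.fun_sum fun k _ =>
    (hasDerivAt_pi.1 hw k).mul (hg.pow (N - 1 - (k : ℕ))))).congr_deriv ?_
  simp only [wPoly, lowPoly, derivative_add, derivative_sum, derivative_X_pow, derivative_C_mul,
    eval_add, eval_finsetSum, eval_mul, eval_C, eval_X, eval_pow, Finset.sum_add_distrib, mul_add,
    Finset.mul_sum]
  rw [add_left_comm]
  congr 1
  rw [mul_comm]
  congr 1
  exact Finset.sum_congr rfl fun k _ => by ring

/-- A simple zero of `w(x; ·)` is locally the graph of a smooth function. -/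
theorem exists_contDiffAt_root {W : ℝ → Fin N → ℝ} (hW : ContDiff ℝ ∞ W) {x t : ℝ}
    (h0 : (wPoly (W x)).eval t = 0) (hd : (derivative (wPoly (W x))).eval t ≠ 0) :
    ∃ g : ℝ → ℝ, ContDiffAt ℝ ∞ g x ∧ g x = t ∧ ∀ᶠ y in 𝓝 x, (wPoly (W y)).eval (g y) = 0 := by
  let f : ℝ × ℝ → ℝ := fun p => (wPoly (W p.1)).eval p.2
  have hf : ContDiff ℝ ∞ f := by
    have hWk : ∀ k, ContDiff ℝ ∞ fun p : ℝ × ℝ => W p.1 k := fun k =>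
      (contDiff_pi.1 hW k).comp contDiff_fst
    simp only [f, eval_wPoly]
    exact (contDiff_snd.pow N).add (ContDiff.sum fun k _ => (hWk k).mul (contDiff_snd.pow _))
  have hinf : (∞ : WithTop ℕ∞) ≠ 0 := by simp
  have cdf : ContDiffAt ℝ ∞ f (x, t) := hf.contDiffAt
  -- The partial derivative in the second variable is multiplication by the nonzero number in `hd`.
  have hinv : (fderiv ℝ f (x, t) ∘L .inr ℝ ℝ ℝ).IsInvertible := by
    refine ⟨ContinuousLinearEquiv.unitsEquivAut ℝ (Units.mk0 _ hd), ?_⟩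
    ext
    have h1 : HasFDerivAt f (fderiv ℝ f (x, t)) (x, t) :=
      (cdf.differentiableAt hinf).hasFDerivAt
    have h2 : HasDerivAt (fun s => f (x, s)) (fderiv ℝ f (x, t) (0, 1)) t :=
      h1.comp_hasDerivAt t ((hasDerivAt_const t x).prodMk (hasDerivAt_id t))
    have h3 : HasDerivAt (fun s => f (x, s)) ((derivative (wPoly (W x))).eval t) t :=
      (wPoly (W x)).hasDerivAt t
    simp [h2.unique h3]
  refine ⟨cdf.implicitFunction hinf hinv, cdf.contDiffAt_implicitFunction hinf hinv,
    cdf.implicitFunction_apply_self hinf hinv, ?_⟩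
  filter_upwards [cdf.eventually_apply_implicitFunction hinf hinv] with y hy
  exact hy.trans h0

/-- Only the i-th root can lie in the open i-th gap, so a continuous branch of roots starting there
must be `q · i`. -/
theorem eventually_eq_root {r : Fin (2 * N + 1) → ℝ} (hr : Monotone r) {W : ℝ → Fin N → ℝ}
    {q : ℝ → Fin N → ℝ} (hq : ∀ x, wPoly (W x) = ∏ i, (X - C (q x i)))
    (hgap : ∀ x, InGaps r (q x)) {x : ℝ} {i : Fin N} {g : ℝ → ℝ} (hg : ContinuousAt g x)
    (hgx : g x = q x i) (h0 : ∀ᶠ y in 𝓝 x, (wPoly (W y)).eval (g y) = 0)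
    (h1 : gapLeft r i < q x i) (h2 : q x i < gapRight r i) :
    (fun y => q y i) =ᶠ[𝓝 x] g := by
  rw [← hgx] at h1 h2
  filter_upwards [h0, hg.eventually (isOpen_Ioo.mem_nhds ⟨h1, h2⟩)] with y hy hy'
  rw [hq, eval_prod, Finset.prod_eq_zero_iff] at hy
  obtain ⟨s, -, hs⟩ := hy
  simp only [eval_sub, eval_X, eval_C, sub_eq_zero] at hs
  by_cases hsi : s = i
  · rw [hs, hsi]
  · rw [hs] at hy'
    rcases (hgap y).notMem_Ioo hr hsi with h | h
    · exact absurd hy'.1 (not_lt.2 h)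
    · exact absurd hy'.2 (not_lt.2 h)

end GlobalBehaviour

theorem mainTheorem3 {N : ℕ} [NeZero N] (m₀ : ℝ) (hm₀ : 0 < m₀)
    (c : Fin (2 * N) → ℝ)
    (r : Fin (2 * N + 1) → ℝ) (hr : Monotone r)
    (hC : basePoly c = ∏ j, (X - C (r j)))
    (J : Set ℝ) (hJ : IsOpen J) (hJ' : J.OrdConnected) (h0 : (0 : ℝ) ∈ J)
    (w : ℝ → Fin N → ℝ) (hw : IsBaseSolutionOn m₀ c J w)
    (q₀ : Fin N → ℝ) (hq₀ : IsRootList (w 0) q₀) (hgap : InGaps r q₀)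
    (hcoll : Function.Injective q₀ ∨
      ∀ᶠ x in 𝓝 (0 : ℝ), ∃ p : Fin N → ℝ, IsRootList (w x) p ∧ InGaps r p) :
    ∃ (W : ℝ → Fin N → ℝ) (q : ℝ → Fin N → ℝ),
      EqOn W w J ∧ ContDiff ℝ ∞ W ∧ IsBaseSolutionOn m₀ c univ W ∧
      (∀ x, IsRootList (W x) (q x) ∧ InGaps r (q x)) ∧
      ∀ (i : Fin N) (x₀ : ℝ), gapLeft r i < q x₀ i → q x₀ i < gapRight r i →
        ∀ I : Set ℝ,
          I = connectedComponentIn {x | gapLeft r i < q x i ∧ q x i < gapRight r i} x₀ →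
          IsOpen I ∧ ContDiffOn ℝ ∞ (fun x => q x i) I ∧
          ∀ x ∈ I,
            deriv (fun y => q y i) x ≠ 0 ∧
            1 / 2 * (deriv (fun y => q y i) x * ∏ s ∈ Finset.univ.erase i, (q x i - q x s)) ^ 2
              = -((basePoly c).eval (q x i) / m₀) := by
  have hρ := oddNode_monotone hr
  obtain ⟨z₀, hz1, hz2, hz3, hz4, hz5, hz6⟩ := hcoll.elim
    (exists_neumann_data_of_injective hm₀ hr hC (hw 0 h0).2.2 hq₀ hgap)
    (exists_neumann_data_of_eventually hm₀ hr hC hJ h0 hw)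
  obtain ⟨W, hWs, hW, hW0, hW1, hWα⟩ :=
    exists_global_baseSolution hm₀ c (oddNode r) z₀ hz1 hz2 (w 0) hz3 hz5 hz6
  have hroots : ∀ x, ∃ q : Fin N → ℝ, Interlaces (oddNode r) q ∧
      wPoly (W x) = ∏ i, (X - C (q i)) := by
    intro x
    obtain ⟨α, hα, hs, hWx⟩ := hWα x
    rw [hWx]
    exact exists_interlaces hρ hα hs
  choose q hqI hq using hroots
  have hqgap : ∀ x, InGaps r (q x) := fun x =>
    inGaps_of_inGaps_zero hm₀ hr hC hW (hW0.symm ▸ hq₀) hgap (hq x) (hqI x)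
  refine ⟨W, q, hw.eqOn hm₀.ne' hJ' (fun x _ => hW x (mem_univ x)) h0 hW0
    (lowPoly_injective (hW1.trans hz4.symm)), hWs, hW,
    fun x => ⟨⟨(hqI x).monotone hρ, hq x⟩, hqgap x⟩, ?_⟩
  intro i x₀ _ _ I hI
  set U := {x | gapLeft r i < q x i ∧ q x i < gapRight r i} with hU
  have hD : ∀ x ∈ U, (derivative (wPoly (W x))).eval (q x i) ≠ 0 := by
    intro x hx
    rw [hq, eval_derivative_prod, Finset.prod_ne_zero_iff]
    intro s hs
    rw [sub_ne_zero]
    intro h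
    rcases (hqgap x).notMem_Ioo hr (Finset.ne_of_mem_erase hs) with h' | h'
    · exact absurd hx.1 (not_lt.2 (h ▸ h'))
    · exact absurd hx.2 (not_lt.2 (h ▸ h'))
  have hroot : ∀ x, (wPoly (W x)).eval (q x i) = 0 := by
    intro x
    rw [hq, eval_prod]
    exact Finset.prod_eq_zero (Finset.mem_univ i) (by simp)
  have hsmooth : ∀ x ∈ U, ContDiffAt ℝ ∞ (fun y => q y i) x := by
    intro x hx
    obtain ⟨g, hg, hgx, hg0⟩ := exists_contDiffAt_root hWs (hroot x) (hD x hx)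
    exact hg.congr_of_eventuallyEq
      (eventually_eq_root hr hq hqgap hg.continuousAt hgx hg0 hx.1 hx.2)
  have hUo : IsOpen U := isOpen_iff_mem_nhds.2 fun x hx =>
    (hsmooth x hx).continuousAt.preimage_mem_nhds (isOpen_Ioo.mem_nhds hx)
  have hIU : I ⊆ U := hI ▸ connectedComponentIn_subset U x₀
  refine ⟨hI ▸ hUo.connectedComponentIn,
    fun x hx => (hsmooth x (hIU hx)).contDiffWithinAt, fun x hx => ?_⟩
  have hx := hIU hx
  have hqd : HasDerivAt (fun y => q y i) (deriv (fun y => q y i) x) x :=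
    ((hsmooth x hx).differentiableAt (by simp)).hasDerivAt
  have hzero := (hW x (mem_univ x)).1.hasDerivAt.eval_wPoly hqd
  simp only [hroot] at hzero
  -- Differentiating w(x; q_i(x)) = 0 expresses w_x at q_i through q_i'.
  have hsum := hzero.unique (hasDerivAt_const x 0)
  have hDx := hD x hx
  have hprod : (derivative (wPoly (W x))).eval (q x i)
      = ∏ s ∈ Finset.univ.erase i, (q x i - q x s) := by
    rw [hq, eval_derivative_prod]
  have hCx : (basePoly c).eval (q x i) =
      -(m₀ * (1 / 2 * (deriv (fun y => q y i) x *
        ∏ s ∈ Finset.univ.erase i, (q x i - q x s)) ^ 2)) := by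
    rw [(hW x (mem_univ x)).2.2, ← hprod]
    simp only [eval_mul, eval_add, eval_sub, eval_pow, eval_X, eval_C, hroot]
    rw [eq_neg_of_add_eq_zero_left hsum]
    ring
  constructor
  -- If q_i' vanished, so would C(q_i); but C has no root inside an open gap.
  · intro h
    refine eval_basePoly_ne_zero hr hC hx.1 hx.2 ?_
    rw [hCx, h]
    ring
  · rw [hCx]
    field_simp
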